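/- **Setting.** A branching random walk starts with one ancestor at the origin of $\mathbb R$. Each individual $u$, located at $S(u)$, has a random number $J(u)\in\{0,1,2,\dots\}\cup\{\infty\}$ of children, placed at $S(u)+X_1(u),S(u)+X_2(u),\dots$; different individuals reproduce independently, the point processes $\sum_{i=1}^{J(u)}\delta_{X_i(u)}$ are identically distributed, and for fixed $u$ the dependence between $J(u),X_1(u),X_2(u),\dots$ is arbitrary. Write $|u|=n$ if $u$ belongs to generation $n$, let $J$ be the number of children of the ancestor, and assume that the walk is supercritical: $\mathbb E J>1$. Let $\mu$ be the intensity measure of $\sum_{|u|=1}\delta_{S(u)}$, and put $$m(\lambda)=\int_{\mathbb R}e^{-\lambda x}\,\mu(dx),\qquad Z_n(\lambda)=\frac1{m(\lambda)^n}\sum_{|u|=n}e^{-\lambda S(u)}$$ whenever the integral converges absolutely and, for $Z_n(\lambda)$, $m(\lambda)\ne0$; for real $t$ we allow $m(t)=\infty$. **Theorem 3.4.** Let $p\ge 2$ be real, $\theta,\gamma\in\mathbb R$, $\gamma\neq0$, $\lambda=\theta+i\gamma$, and suppose that $0<|m(\lambda)|<m(\theta)<\infty$ and that the martingale is not trivial,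 i.e. $\mathbb P\{Z_1(\lambda)=1\}<1$. (a) If $\theta\ne0$, then $(Z_n(\lambda))_{n\ge0}$ converges in $L^p$ if and only if $$\mathbb E|Z_1(\lambda)|^p<\infty,\qquad \max\Big(\frac{m(2\theta)}{|m(\lambda)|^2},\frac{m(p\theta)}{|m(\lambda)|^p}\Big)<1,$$ and, when $p>2$, $\ \mathbb E\,[Z_1(2\theta)]^{p/2}<\infty$. (b) If $\theta=0$, then $(Z_n(\lambda))_{n\ge0}$ converges in $L^p$ if and only if $$\mathbb E|Z_1(\lambda)|^p<\infty,\qquad \mathbb E\,[Z_1(0)]^{p/2}<\infty,\qquad \frac{m(0)}{|m(\lambda)|^2}<1.$$ -/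

import Mathlib

open MeasureTheory ProbabilityTheory Filter Topology
open scoped ENNReal

noncomputable section

open Classical in
/-- The point configuration `∑_{i < j} δ_{x i}` on the real line; the number `j` of points
may be `0` or `∞`. -/
def pointConfiguration (j : ℕ∞) (x : ℕ → ℝ) : Measure ℝ :=
  Measure.sum fun i : ℕ => if (i : ℕ∞) < j then Measure.dirac (x i) else 0

open Classical in
/-- A branching random walk on a probability space `(Ω, P)`.

Individuals are words over `ℕ`, written with the youngest letter first: the `i`-th child
(`i = 0, 1, 2, …`) of `u` is `i :: u`, and the ancestor is `[]`. The individual `u` has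
`J u` children (possibly infinitely many), displaced from `u` by `X u i`, `i < J u`.
The values `X u i` with `i ≥ J u` are irrelevant: they enter neither the independence
assumption nor the point processes. For fixed `u` the dependence between
`J u, X u 0, X u 1, …` is arbitrary. -/
structure BranchingRandomWalk {Ω : Type*} [MeasurableSpace Ω] (P : Measure Ω) where
  /-- number of children of an individual -/
  J : List ℕ → Ω → ℕ∞
  /-- displacements of the children of an individual -/
  X : List ℕ → ℕ → Ω → ℝ
  measurable_J : ∀ u, Measurable (J u)
  measurable_X : ∀ u i, Measurable (X u i)
  /-- different individuals reproduce independently -/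
  indep : iIndepFun
    (fun u ω => ((J u ω, fun i => if (i : ℕ∞) < J u ω then X u i ω else 0) : ℕ∞ × (ℕ → ℝ))) P
  /-- the point processes of all individuals are copies of that of the ancestor -/
  identDistrib : ∀ u, IdentDistrib
    (fun ω => pointConfiguration (J u ω) (fun i => X u i ω))
    (fun ω => pointConfiguration (J [] ω) (fun i => X [] i ω)) P P

namespace BranchingRandomWalk

variable {Ω : Type*} [MeasurableSpace Ω] {P : Measure Ω} (B : BranchingRandomWalk P)

/-- The word `u` is an individual that is actually born. -/
def Born : List ℕ → Ω → Prop
  | [], _ => True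
  | i :: u, ω => Born u ω ∧ (i : ℕ∞) < B.J u ω

/-- The position `S(u)` of the individual `u`. -/
def S : List ℕ → Ω → ℝ
  | [], _ => 0
  | i :: u, ω => S u ω + B.X u i ω

open Classical in
/-- The point process of the positions of the individuals of generation `n`. -/
def generation (n : ℕ) (ω : Ω) : Measure ℝ :=
  Measure.sum fun u : List ℕ =>
    if u.length = n ∧ B.Born u ω then Measure.dirac (B.S u ω) else 0

/-- The intensity measure `A ↦ E[M(A)]` of the reproduction point process `M`. -/
def intensity : Measure ℝ :=
  P.bind fun ω => pointConfiguration (B.J [] ω) (fun i => B.X [] i ω)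

/-- The mean number of children of an individual exceeds one. -/
def Supercritical : Prop :=
  1 < ∫⁻ ω, (B.J [] ω : ℝ≥0∞) ∂P

/-- The Laplace transform of the intensity measure at a real argument, with values in
`[0, ∞]`. -/
def mReal (t : ℝ) : ℝ≥0∞ :=
  ∫⁻ x, ENNReal.ofReal (Real.exp (-t * x)) ∂B.intensity

/-- The Laplace transform `m(z)` of the intensity measure at a complex argument. It is
meaningful where it converges absolutely, that is, where `mReal z.re < ∞`. -/
def m (z : ℂ) : ℂ :=
  ∫ x : ℝ, Complex.exp (-z * x) ∂B.intensity

/-- The Biggins martingale `Z_n(z) = m(z)⁻ⁿ ∑_{|u| = n} exp(-z S(u))`, for complex `z` such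
that `m(z)` converges absolutely and is not zero. -/
def Z (n : ℕ) (z : ℂ) (ω : Ω) : ℂ :=
  (∫ x : ℝ, Complex.exp (-z * x) ∂(B.generation n ω)) / B.m z ^ n

/-- The Biggins martingale at a real argument `t` with `m(t) < ∞`, as a `[0, ∞]`-valued
random variable. -/
def ZReal (n : ℕ) (t : ℝ) (ω : Ω) : ℝ≥0∞ :=
  (∫⁻ x, ENNReal.ofReal (Real.exp (-t * x)) ∂(B.generation n ω)) / B.mReal t ^ n

end BranchingRandomWalk

/-- Convergence in `L^p` of a sequence of complex random variables. -/
def ConvergesInLp {Ω : Type*} [MeasurableSpace Ω] (P : Measure Ω) (p : ℝ)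
    (Y : ℕ → Ω → ℂ) : Prop :=
  (∀ n, MemLp (Y n) (ENNReal.ofReal p) P) ∧
    ∃ Y' : Ω → ℂ, MemLp Y' (ENNReal.ofReal p) P ∧
      Tendsto (fun n => eLpNorm (fun ω => Y n ω - Y' ω) (ENNReal.ofReal p) P) atTop (𝓝 0)

end

noncomputable section

/-! ### Elementary inequalities -/

/-! Let `W_n = ∑_{|u|=n} exp(-2θ S(u))`, which is `realSum n (2 * θ)`. The increment `Z_{n+1} - Z_n`
equals `m(λ)^{-n}` times a sum over generation `n` of `exp(-λ S(u))` multiplied by independent,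
identically distributed centred variables that are independent of the first `n` generations. Given
those generations and `p ≥ 2`, the `p`-th moment of such a sum with coefficients `c_u` is comparable
to `(∑ |c_u|²)^{p/2}`: from above by a Rosenthal-type induction
(`exists_lintegral_enorm_tsum_rpow_le`), from below by Jensen and orthogonality
(`le_lintegral_enorm_tsum_rpow`). So, once `Z_1` has a finite `p`-th moment, `E|Z_{n+1} - Z_n|^p` is
comparable to `E W_n^{p/2} / |m(λ)|^{pn}`.

Necessity: convergence makes these quantities finite and null. Since `E W_n^{p/2}` is at least `(E
W_n)^{p/2} = m(2θ)^{np/2}` and at least `E ∑ exp(-pθ S(u)) = m(pθ)^n`, both ratios are below one;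
finiteness at `n = 1` is the moment condition on `W_1`.

Sufficiency: conditioning once more gives `E W_{n+1}^{p/2} ≤ A^{p/2} E W_n^{p/2} + C m(pθ)^n` for
any `A > m(2θ)` (`exists_lintegral_tsum_rpow_le`). Hence `E W_n^{p/2}` grows at a geometric rate
below `|m(λ)|^p`, and the increments are geometrically summable in `L^p`. Both parts of the theorem
are rewritings of the resulting criterion `convergesInLp_iff`. -/

/-- The factor of the dominant term may be as close to `1` as desired, at the cost of `C`: if `x ≤ δ
y` the sum is at most `(1 + δ) y`, otherwise `y` is at most `x / δ`. -/
theorem ENNReal.exists_add_rpow_le {r : ℝ} (hr : 0 < r) {κ : ℝ≥0∞} (hκ : 1 < κ) :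
    ∃ C : ℝ≥0∞, C ≠ ∞ ∧ ∀ x y : ℝ≥0∞, (x + y) ^ r ≤ κ * y ^ r + C * x ^ r := by
  obtain ⟨κ', h1, h2⟩ := ENNReal.lt_iff_exists_nnreal_btwn.1 hκ
  have hd : (1 : ℝ≥0∞) < (κ' : ℝ≥0∞) ^ r⁻¹ := ENNReal.one_lt_rpow h1 (by positivity)
  obtain ⟨d, hd1, hd2⟩ := ENNReal.lt_iff_exists_nnreal_btwn.1 hd
  have hd1' : 1 < d := by exact_mod_cast hd1
  set δ := d - 1 with hδ
  have hδ0 : 0 < δ := tsub_pos_of_lt hd1'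
  have hdδ : (d : ℝ≥0∞) = δ + 1 := by
    rw [hδ]; exact_mod_cast (tsub_add_cancel_of_le hd1'.le).symm
  refine ⟨(1 + (δ : ℝ≥0∞)⁻¹) ^ r, ?_, fun x y => ?_⟩
  · exact ENNReal.rpow_ne_top_of_nonneg hr.le (by simp [hδ0.ne'])
  rcases le_total x (δ * y) with h | h
  · refine le_trans ?_ (le_add_right le_rfl)
    calc (x + y) ^ r ≤ (d * y) ^ r := by
          apply ENNReal.rpow_le_rpow _ hr.le
          rw [hdδ, add_mul, one_mul]; gcongr
      _ = (d : ℝ≥0∞) ^ r * y ^ r := ENNReal.mul_rpow_of_nonneg _ _ hr.le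
      _ ≤ κ * y ^ r := by
          gcongr
          calc (d : ℝ≥0∞) ^ r ≤ ((κ' : ℝ≥0∞) ^ r⁻¹) ^ r := ENNReal.rpow_le_rpow hd2.le hr.le
            _ = κ' := by rw [← ENNReal.rpow_mul, inv_mul_cancel₀ hr.ne', ENNReal.rpow_one]
            _ ≤ κ := h2.le
  · refine le_trans ?_ (le_add_left le_rfl)
    rw [← ENNReal.mul_rpow_of_nonneg _ _ hr.le]
    apply ENNReal.rpow_le_rpow _ hr.le
    rw [add_mul, one_mul]
    gcongr
    rw [mul_comm, ← div_eq_mul_inv, ENNReal.le_div_iff_mul_le (by simp [hδ0.ne']) (by simp), mul_comm]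
    exact h

/-- Young's inequality with a small constant, used to absorb mixed terms; the cases are `y ≤ d x`
and `d x ≤ y` with `d ^ r ≤ η`. -/
theorem ENNReal.exists_mul_rpow_le {r : ℝ} (hr : 0 < r) {η : ℝ≥0∞} (hη : η ≠ 0) :
    ∃ C : ℝ≥0∞, C ≠ ∞ ∧ ∀ x y : ℝ≥0∞, x * y ^ r ≤ η * x ^ (r + 1) + C * y ^ (r + 1) := by
  have hd : (0 : ℝ≥0∞) < η ^ r⁻¹ := by
    rw [pos_iff_ne_zero, Ne, ENNReal.rpow_eq_zero_iff]
    rintro (h | h)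
    · exact hη h.1
    · have : 0 < r⁻¹ := by positivity
      linarith [h.2]
  obtain ⟨d, hd1, hd2⟩ := ENNReal.lt_iff_exists_nnreal_btwn.1 hd
  have hd0 : (d : ℝ≥0∞) ≠ 0 := hd1.ne'
  refine ⟨(d : ℝ≥0∞)⁻¹, by simpa using hd0, fun x y => ?_⟩
  have key : ∀ t : ℝ≥0∞, t * t ^ r = t ^ (r + 1) := fun t => by
    rw [ENNReal.rpow_add_of_nonneg r 1 hr.le zero_le_one, ENNReal.rpow_one, mul_comm]
  rcases le_total y (d * x) with h | h
  · refine le_trans ?_ (le_add_right le_rfl)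
    calc x * y ^ r ≤ x * (d * x) ^ r := by gcongr
      _ = (d : ℝ≥0∞) ^ r * (x * x ^ r) := by
        rw [ENNReal.mul_rpow_of_nonneg _ _ hr.le]; ring
      _ ≤ η * x ^ (r + 1) := by
        rw [key]
        gcongr
        calc (d : ℝ≥0∞) ^ r ≤ (η ^ r⁻¹) ^ r := ENNReal.rpow_le_rpow hd2.le hr.le
            _ = η := by rw [← ENNReal.rpow_mul, inv_mul_cancel₀ hr.ne', ENNReal.rpow_one]
  · refine le_trans ?_ (le_add_left le_rfl)
    rw [← key y, ← mul_assoc]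
    gcongr
    rw [mul_comm, ← div_eq_mul_inv, ENNReal.le_div_iff_mul_le (by simp [hd0]) (by simp), mul_comm]
    exact h

theorem ENNReal.rpow_le_one_add_rpow {s r : ℝ} (hs : 0 ≤ s) (hsr : s ≤ r) (x : ℝ≥0∞) :
    x ^ s ≤ 1 + x ^ r := by
  rcases le_total x 1 with h | h
  · exact (ENNReal.rpow_le_one h hs).trans (le_add_right le_rfl)
  · exact (ENNReal.rpow_le_rpow_of_exponent_le h hsr).trans (le_add_left le_rfl)

theorem Real.abs_one_add_rpow_sub_one_le {s : ℝ} (hs : 0 ≤ s) :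
    ∃ C : ℝ, 0 ≤ C ∧ ∀ t : ℝ, -1 ≤ t → t ≤ 3 → |(1 + t) ^ s - 1| ≤ C * |t| := by
  refine ⟨1 + s * 4 ^ s, by positivity, fun t h1 h2 => ?_⟩
  have h4 : (0 : ℝ) ≤ s * 4 ^ s := by positivity
  rcases le_total 0 t with ht | ht
  · rw [abs_of_nonneg ht, abs_of_nonneg (by linarith [Real.one_le_rpow (by linarith : 1 ≤ 1 + t) hs])]
    rcases le_total s 1 with hs1 | hs1
    · have := rpow_one_add_le_one_add_mul_self h1 hs hs1
      nlinarith
    · have hp : (0 : ℝ) < 1 + t := by linarith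
      -- Bernoulli at the reciprocal `(1 + t)⁻¹` turns the lower bound for powers into an upper
      -- bound.
      have hb := one_add_mul_self_le_rpow_one_add (s := (1 + t)⁻¹ - 1) (by
        have := inv_pos.2 hp; linarith) hs1
      rw [add_sub_cancel, Real.inv_rpow hp.le] at hb
      have hq : (0 : ℝ) < (1 + t) ^ s := Real.rpow_pos_of_pos hp s
      have hle : (1 + t) ^ s ≤ 4 ^ s := Real.rpow_le_rpow hp.le (by linarith) hs
      have hb' := mul_le_mul_of_nonneg_right hb hq.le
      rw [inv_mul_cancel₀ hq.ne'] at hb'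
      have e : s * ((1 + t)⁻¹ - 1) = - (s * (t / (1 + t))) := by field_simp; ring
      rw [e] at hb'
      have h5 : t / (1 + t) ≤ t := div_le_self ht (by linarith)
      have h6 : 0 ≤ t / (1 + t) := by positivity
      have h7 : s * (t / (1 + t)) * (1 + t) ^ s ≤ s * t * 4 ^ s := by gcongr
      nlinarith
  · rw [abs_of_nonpos ht]
    have h0 : 0 ≤ 1 + t := by linarith
    rw [abs_of_nonpos (by linarith [Real.rpow_le_one h0 (by linarith) hs])]
    rcases le_total s 1 with hs1 | hs1
    · have : 1 + t ≤ (1 + t) ^ s := by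
        rcases h0.eq_or_lt with h | h
        · rw [← h]; exact Real.rpow_nonneg le_rfl _
        · simpa using Real.rpow_le_rpow_of_exponent_ge h (by linarith) hs1
      nlinarith
    · have := one_add_mul_self_le_rpow_one_add h1 hs1
      have h8 : (1 : ℝ) ≤ 4 ^ s := Real.one_le_rpow (by norm_num) hs
      nlinarith [mul_le_mul_of_nonneg_left h8 hs]

/-- Bernoulli at `(1 + t)⁻¹` gives `(1 + t)^r ≤ 1 + r t (1 + t)^(r-1)`; replacing the last power by
`1` costs a quadratic error by the Lipschitz bound. -/
theorem Real.exists_one_add_rpow_le {r : ℝ} (hr : 1 ≤ r) :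
    ∃ C : ℝ, 0 ≤ C ∧ ∀ t : ℝ, -1 ≤ t → t ≤ 3 → (1 + t) ^ r ≤ 1 + r * t + C * t ^ 2 := by
  obtain ⟨C, hC, h⟩ := Real.abs_one_add_rpow_sub_one_le (s := r - 1) (by linarith)
  refine ⟨r * C, by positivity, fun t h1 h2 => ?_⟩
  have h0 : 0 ≤ 1 + t := by linarith
  rcases h0.eq_or_lt with h0 | h0
  · have ht : t = -1 := by linarith
    have h3 := h t h1 h2
    rw [← h0, Real.zero_rpow (by linarith)]
    subst ht
    rcases hr.eq_or_lt with rfl | hr1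
    · norm_num; linarith
    · rw [← h0, Real.zero_rpow (by linarith)] at h3
      norm_num at h3
      nlinarith
  · have hb := one_add_mul_self_le_rpow_one_add (s := (1 + t)⁻¹ - 1) (by
        have := inv_pos.2 h0; linarith) hr
    rw [add_sub_cancel, Real.inv_rpow h0.le] at hb
    have hq : (0 : ℝ) < (1 + t) ^ r := Real.rpow_pos_of_pos h0 r
    have hb' := mul_le_mul_of_nonneg_right hb hq.le
    rw [inv_mul_cancel₀ hq.ne'] at hb'
    have e : (1 + r * ((1 + t)⁻¹ - 1)) * (1 + t) ^ r
        = (1 + t) ^ r - r * t * (1 + t) ^ (r - 1) := by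
      rw [Real.rpow_sub_one h0.ne']; field_simp; ring
    rw [e] at hb'
    have h3 := h t h1 h2
    have h4 : t * ((1 + t) ^ (r - 1) - 1) ≤ C * t ^ 2 := by
      calc _ ≤ |t| * |(1 + t) ^ (r - 1) - 1| := by rw [← abs_mul]; exact le_abs_self _
        _ ≤ |t| * (C * |t|) := by gcongr
        _ = C * t ^ 2 := by rw [← sq_abs t]; ring
    nlinarith

/-- A second order Taylor bound for `x ↦ |x| ^ p` on the complex plane. -/
theorem Complex.exists_norm_add_rpow_le {p : ℝ} (hp : 2 ≤ p) :
    ∃ C : ℝ, 0 ≤ C ∧ ∀ x y : ℂ, ‖x + y‖ ^ p ≤ ‖x‖ ^ p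
      + p * ‖x‖ ^ (p - 2) * ((starRingEnd ℂ) x * y).re
      + C * (‖x‖ ^ (p - 2) * ‖y‖ ^ 2 + ‖y‖ ^ p) := by
  obtain ⟨C, hC, h⟩ := Real.exists_one_add_rpow_le (r := p / 2) (by linarith)
  -- `2 ^ p + p` serves the case `‖x‖ ≤ ‖y‖`, where every term is compared with `‖y‖ ^ p`; `p + 9 *
  -- C` serves the Taylor case `‖y‖ ≤ ‖x‖`.
  refine ⟨p + 9 * C + 2 ^ p + p, by positivity, fun x y => ?_⟩
  have hre : |((starRingEnd ℂ) x * y).re| ≤ ‖x‖ * ‖y‖ := by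
    refine (Complex.abs_re_le_norm _).trans ?_
    rw [norm_mul, RCLike.norm_conj]
  have hx0 := norm_nonneg x
  have hy0 := norm_nonneg y
  have hxp : 0 ≤ ‖x‖ ^ (p - 2) := Real.rpow_nonneg hx0 _
  have hyp : 0 ≤ ‖y‖ ^ p := Real.rpow_nonneg hy0 _
  have h2p : (0 : ℝ) ≤ 2 ^ p := by positivity
  rcases le_total ‖x‖ ‖y‖ with hxy | hxy
  · have h1 : ‖x + y‖ ^ p ≤ 2 ^ p * ‖y‖ ^ p := by
      rw [← Real.mul_rpow (by norm_num) hy0]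
      exact Real.rpow_le_rpow (norm_nonneg _) (by linarith [norm_add_le x y]) (by linarith)
    have h2 : ‖x‖ ^ (p - 2) * (‖x‖ * ‖y‖) ≤ ‖y‖ ^ p := by
      calc _ ≤ ‖y‖ ^ (p - 2) * (‖y‖ * ‖y‖) := by
            gcongr
        _ = ‖y‖ ^ p := by
            rcases hy0.eq_or_lt with h0 | h0
            · rw [← h0, Real.zero_rpow (by linarith : p ≠ 0)]; simp
            · rw [Real.rpow_sub h0, Real.rpow_two]; field_simp
    have h3 : -(‖y‖ ^ p) ≤ ‖x‖ ^ (p - 2) * ((starRingEnd ℂ) x * y).re := by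
      have := mul_le_mul_of_nonneg_left (neg_le_of_abs_le hre) hxp
      linarith
    have h4 : 0 ≤ ‖x‖ ^ p := Real.rpow_nonneg hx0 _
    have h5 : 0 ≤ ‖x‖ ^ (p - 2) * ‖y‖ ^ 2 := by positivity
    have h6 := mul_le_mul_of_nonneg_left h3 (by linarith : 0 ≤ p)
    have h7 : 0 ≤ (p + 9 * C + 2 ^ p + p) * (‖x‖ ^ (p - 2) * ‖y‖ ^ 2) := by positivity
    have h8 : 0 ≤ (p + 9 * C) * ‖y‖ ^ p := by positivity
    nlinarith
  · rcases hx0.eq_or_lt with h0 | h0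
    · have hy : y = 0 := norm_eq_zero.1 (by linarith)
      have hx : x = 0 := norm_eq_zero.1 h0.symm
      subst hx hy
      simp [Real.zero_rpow (by linarith : p ≠ 0)]
    -- The relative change of the squared norm, `‖x + y‖² = ‖x‖² (1 + t)`, so the scalar bound
    -- applies with exponent `p / 2`; `‖y‖ ≤ ‖x‖` gives `|t| ≤ 3`.
    set t := (2 * ((starRingEnd ℂ) x * y).re + ‖y‖ ^ 2) / ‖x‖ ^ 2 with ht
    have hsq : ‖x + y‖ ^ 2 = ‖x‖ ^ 2 * (1 + t) := by
      rw [ht, mul_add, mul_div_cancel₀ _ (by positivity), Complex.sq_norm, Complex.sq_norm,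
        Complex.sq_norm, Complex.normSq_add]
      have : (x * (starRingEnd ℂ) y).re = ((starRingEnd ℂ) x * y).re := by
        simp [Complex.mul_re]
      rw [this]; ring
    have h1t : 0 ≤ 1 + t := by
      by_contra hc
      have : ‖x‖ ^ 2 * (1 + t) < 0 := mul_neg_of_pos_of_neg (by positivity) (by linarith)
      have := sq_nonneg ‖x + y‖
      linarith
    have hb := abs_le.1 hre
    have ht3 : |t| ≤ 3 * (‖y‖ / ‖x‖) := by
      rw [ht, abs_div, abs_of_pos (by positivity : 0 < ‖x‖ ^ 2), div_le_iff₀ (by positivity)]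
      have : 3 * (‖y‖ / ‖x‖) * ‖x‖ ^ 2 = 3 * (‖y‖ * ‖x‖) := by field_simp
      rw [this, abs_le]
      constructor <;> nlinarith
    have hyx : ‖y‖ / ‖x‖ ≤ 1 := (div_le_one h0).2 hxy
    have hT := h t (by linarith) (by linarith [le_abs_self t])
    have e1 : ‖x + y‖ ^ p = ‖x‖ ^ p * (1 + t) ^ (p / 2) := by
      have : ∀ w : ℂ, ‖w‖ ^ p = (‖w‖ ^ 2) ^ (p / 2) := fun w => by
        rw [← Real.rpow_natCast, ← Real.rpow_mul (norm_nonneg _)]; congr 1; push_cast; ring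
      rw [this, this, hsq, Real.mul_rpow (by positivity) h1t]
    have e2 : ‖x‖ ^ p = ‖x‖ ^ (p - 2) * ‖x‖ ^ 2 := by
      rw [Real.rpow_sub h0, Real.rpow_two]; field_simp
    have e3 : ‖x‖ ^ 2 * t = 2 * ((starRingEnd ℂ) x * y).re + ‖y‖ ^ 2 := by
      rw [ht]; field_simp
    have e4 : ‖x‖ ^ 2 * t ^ 2 ≤ 9 * ‖y‖ ^ 2 := by
      have : t ^ 2 ≤ (3 * (‖y‖ / ‖x‖)) ^ 2 := by
        rw [← sq_abs t]; gcongr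
      calc _ ≤ ‖x‖ ^ 2 * (3 * (‖y‖ / ‖x‖)) ^ 2 := by gcongr
        _ = 9 * ‖y‖ ^ 2 := by field_simp; ring
    have e5 : ‖x‖ ^ 2 * (1 + t) ^ (p / 2) ≤
        ‖x‖ ^ 2 + p * ((starRingEnd ℂ) x * y).re + (p + 9 * C) * ‖y‖ ^ 2 := by
      have h9 := mul_le_mul_of_nonneg_left hT (by positivity : 0 ≤ ‖x‖ ^ 2)
      have h10 := mul_le_mul_of_nonneg_left e4 hC
      have h11 : 0 ≤ p * ‖y‖ ^ 2 := by positivity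
      have h12 : ‖x‖ ^ 2 * (1 + p / 2 * t + C * t ^ 2)
          = ‖x‖ ^ 2 + p / 2 * (‖x‖ ^ 2 * t) + C * (‖x‖ ^ 2 * t ^ 2) := by ring
      rw [h12, e3] at h9
      nlinarith
    rw [e1]
    nth_rewrite 1 [e2]
    rw [e2, mul_assoc]
    have h13 := mul_le_mul_of_nonneg_left e5 hxp
    have h14 : 0 ≤ (2 ^ p + p) * (‖x‖ ^ (p - 2) * ‖y‖ ^ 2) := by positivity
    have h15 : 0 ≤ (p + 9 * C + 2 ^ p + p) * ‖y‖ ^ p := by positivity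
    nlinarith

/-! ### Moments of sums of independent random variables -/

/-- One summand `x` is decoupled from the rest `R` of the sum: the main term factorises by
independence, the remainder involves `x` only. -/
theorem lintegral_mul_add_rpow_le {Ω : Type*} [MeasurableSpace Ω] {P : Measure Ω}
    {x R : Ω → ℝ≥0∞} (hx : Measurable x) (hR : Measurable R)
    (hxR : IndepFun x R P) {r : ℝ} (hr : 0 < r) {κ C : ℝ≥0∞}
    (hC : ∀ x y : ℝ≥0∞, (x + y) ^ r ≤ κ * y ^ r + C * x ^ r) :
    ∫⁻ ω, x ω * (x ω + R ω) ^ r ∂P ≤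
      κ * ((∫⁻ ω, x ω ∂P) * ∫⁻ ω, R ω ^ r ∂P) + C * ∫⁻ ω, x ω ^ (r + 1) ∂P := by
  have hi : IndepFun x (fun ω => R ω ^ r) P :=
    hxR.comp (φ := id) (ψ := fun t : ℝ≥0∞ => t ^ r) measurable_id (by fun_prop)
  rw [← lintegral_mul_eq_lintegral_mul_lintegral_of_indepFun'' hx.aemeasurable (by fun_prop) hi,
    ← lintegral_const_mul _ (by fun_prop), ← lintegral_const_mul _ (by fun_prop),
    ← lintegral_add_left (by fun_prop)]
  refine lintegral_mono fun ω => ?_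
  have e : x ω ^ (r + 1) = x ω * x ω ^ r := by
    rw [ENNReal.rpow_add_of_nonneg r 1 hr.le zero_le_one, ENNReal.rpow_one, mul_comm]
  calc x ω * (x ω + R ω) ^ r ≤ x ω * (κ * R ω ^ r + C * x ω ^ r) := by gcongr; exact hC _ _
    _ = _ := by rw [e]; ring

section IndependentSums

variable {Ω : Type*} [MeasurableSpace Ω] {P : Measure Ω} [IsProbabilityMeasure P] {ι : Type*}

theorem lintegral_comp_prodMk_of_indepFun {α β : Type*} [MeasurableSpace α] [MeasurableSpace β]
    {f : Ω → α} {g : Ω → β} (hf : Measurable f) (hg : Measurable g) (hfg : IndepFun f g P)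
    {F : α × β → ℝ≥0∞} (hF : Measurable F) :
    ∫⁻ ω, F (f ω, g ω) ∂P = ∫⁻ ω, ∫⁻ ω', F (f ω, g ω') ∂P ∂P := by
  rw [← lintegral_map (f := F) (g := fun ω => (f ω, g ω)) hF (by fun_prop),
    (indepFun_iff_map_prod_eq_prod_map_map hf.aemeasurable hg.aemeasurable).1 hfg]
  have : IsProbabilityMeasure (P.map g) := Measure.isProbabilityMeasure_map hg.aemeasurable
  rw [lintegral_prod _ hF.aemeasurable, lintegral_map hF.lintegral_prod_right' hf]
  refine lintegral_congr fun ω => ?_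
  rw [lintegral_map (by fun_prop) hg]

theorem rpow_lintegral_le_lintegral_rpow {q : ℝ} (hq : 1 ≤ q) {f : Ω → ℝ≥0∞} (hf : Measurable f) :
    (∫⁻ ω, f ω ∂P) ^ q ≤ ∫⁻ ω, f ω ^ q ∂P := by
  have h := eLpNorm'_le_eLpNorm'_of_exponent_le (f := f) one_pos hq P
    hf.aestronglyMeasurable
  simp only [eLpNorm', enorm_eq_self, ENNReal.rpow_one, div_one] at h
  calc _ ≤ ((∫⁻ ω, f ω ^ q ∂P) ^ (1 / q)) ^ q := ENNReal.rpow_le_rpow h (by linarith)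
    _ = _ := by rw [← ENNReal.rpow_mul, one_div_mul_cancel (by linarith), ENNReal.rpow_one]

theorem lintegral_rpow_le_rpow_lintegral {q : ℝ} (hq0 : 0 < q) (hq : q ≤ 1) {f : Ω → ℝ≥0∞}
    (hf : Measurable f) : ∫⁻ ω, f ω ^ q ∂P ≤ (∫⁻ ω, f ω ∂P) ^ q := by
  have h := eLpNorm'_le_eLpNorm'_of_exponent_le (f := f) hq0 hq P
    hf.aestronglyMeasurable
  simp only [eLpNorm', enorm_eq_self, ENNReal.rpow_one, div_one] at h
  calc _ = ((∫⁻ ω, f ω ^ q ∂P) ^ (1 / q)) ^ q := by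
        rw [← ENNReal.rpow_mul, one_div_mul_cancel hq0.ne', ENNReal.rpow_one]
    _ ≤ _ := ENNReal.rpow_le_rpow h hq0.le

/-- The leading constant `A` can be any number above the bound `a` on the means, which keeps the
growth rate sharp. Induction lowers `q` by one: write `T ^ q = ∑ x_u T ^ (q - 1)`, decouple `x_u`
from the other summands, and use the bound for `q - 1` with some `B` between `a` and `A`. -/
theorem exists_lintegral_sum_rpow_le {ξ : ι → Ω → ℝ≥0∞} (hξ : ∀ u, Measurable (ξ u))
    (hind : iIndepFun ξ P) {a : ℝ≥0∞} (ha : a ≠ 0) (hmean : ∀ u, ∫⁻ ω, ξ u ω ∂P ≤ a) (n : ℕ) :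
    ∀ {q : ℝ}, 0 < q → q ≤ n + 1 → ∀ {A M : ℝ≥0∞}, a < A → A ≠ ∞ → M ≠ ∞ →
      (∀ u, ∫⁻ ω, ξ u ω ^ q ∂P ≤ M) →
      ∃ C : ℝ≥0∞, C ≠ ∞ ∧ ∀ (w : ι → ℝ≥0∞) (s : Finset ι),
        ∫⁻ ω, (∑ u ∈ s, w u * ξ u ω) ^ q ∂P ≤ A ^ q * (∑ u ∈ s, w u) ^ q + C * (s.sup w) ^ q := by
  classical
  -- For `q ≤ 1` Jensen's inequality for a concave power suffices, without error term.
  have base : ∀ {q : ℝ}, 0 < q → q ≤ 1 → ∀ {A : ℝ≥0∞}, a < A →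
      ∀ (w : ι → ℝ≥0∞) (s : Finset ι),
        ∫⁻ ω, (∑ u ∈ s, w u * ξ u ω) ^ q ∂P ≤ A ^ q * (∑ u ∈ s, w u) ^ q := by
    intro q hq0 hq1 A hA w s
    refine (lintegral_rpow_le_rpow_lintegral hq0 hq1 (by fun_prop)).trans ?_
    rw [lintegral_finsetSum _ (by fun_prop), ← ENNReal.mul_rpow_of_nonneg _ _ hq0.le]
    refine ENNReal.rpow_le_rpow ?_ hq0.le
    rw [mul_comm, Finset.sum_mul]
    refine Finset.sum_le_sum fun u _ => ?_
    rw [lintegral_const_mul _ (hξ u)]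
    gcongr
    exact (hmean u).trans hA.le
  induction n with
  | zero =>
    intro q hq0 hq1 A M hA _ _ _
    exact ⟨0, by simp, fun w s => (base hq0 (by simpa using hq1) hA w s).trans (by simp)⟩
  | succ n ih =>
    intro q hq0 hqn A M hA hAtop hM hmom
    rcases le_or_gt q 1 with hq1 | hq1
    · exact ⟨0, by simp, fun w s => (base hq0 hq1 hA w s).trans (by simp)⟩
    obtain ⟨B, hB1, hB2⟩ := ENNReal.lt_iff_exists_nnreal_btwn.1 hA
    have hr : 0 < q - 1 := by linarith
    have hatop : a ≠ ∞ := (hA.trans_le le_top).ne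
    obtain ⟨C, hCtop, hC⟩ := ih hr (by push_cast at hqn; linarith) hB1 (by simp)
      (M := 1 + M) (by simpa using hM) (fun u => by
        calc ∫⁻ ω, ξ u ω ^ (q - 1) ∂P ≤ ∫⁻ ω, (1 + ξ u ω ^ q) ∂P :=
              lintegral_mono fun ω => ENNReal.rpow_le_one_add_rpow hr.le (by linarith) _
          _ = 1 + ∫⁻ ω, ξ u ω ^ q ∂P := by
              rw [lintegral_add_left measurable_const]; simp
          _ ≤ 1 + M := by gcongr; exact hmom u)
    -- With `κ = B / a` the decoupled main term carries the factor `κ * a = B`, raising `B ^ (q -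
    -- 1)` to `B ^ q`.
    have hκ : 1 < (B : ℝ≥0∞) / a := by
      rw [ENNReal.lt_div_iff_mul_lt (Or.inl ha) (Or.inl hatop), one_mul]; exact hB1
    obtain ⟨C1, hC1top, hC1⟩ := ENNReal.exists_add_rpow_le hr hκ
    set C2 : ℝ≥0∞ := B * C + C1 * M with hC2
    have hC2top : C2 ≠ ∞ := ENNReal.add_ne_top.2
      ⟨ENNReal.mul_ne_top (by simp) hCtop, ENNReal.mul_ne_top hC1top hM⟩
    have hBA : (B : ℝ≥0∞) ^ q < A ^ q := ENNReal.rpow_lt_rpow hB2 hq0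
    -- `C2` will multiply the mixed term `S * W ^ (q - 1)`; this `η` makes its contribution to the
    -- coefficient of `S ^ q` fit into the gap `A ^ q - B ^ q`.
    obtain ⟨C3, hC3top, hC3⟩ := ENNReal.exists_mul_rpow_le hr
      (η := (A ^ q - (B : ℝ≥0∞) ^ q) / (C2 + 1)) (by
        rw [Ne, ENNReal.div_eq_zero_iff]
        rintro (h | h)
        · exact (tsub_pos_of_lt hBA).ne' h
        · exact (ENNReal.add_ne_top.2 ⟨hC2top, by simp⟩) h)
    refine ⟨C2 * C3, ENNReal.mul_ne_top hC2top hC3top, fun w s => ?_⟩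
    set S := ∑ u ∈ s, w u with hS
    set W := s.sup w with hW
    have hxm : ∀ u, Measurable fun ω => w u * ξ u ω := fun u => (hξ u).const_mul _
    have hxi : iIndepFun (fun u ω => w u * ξ u ω) P :=
      hind.comp (fun u t => w u * t) (fun u => measurable_const_mul _)
    have key : ∀ t : ℝ≥0∞, t * t ^ (q - 1) = t ^ q := fun t => by
      have := ENNReal.rpow_add_of_nonneg (x := t) (q - 1) 1 hr.le zero_le_one
      rw [sub_add_cancel, ENNReal.rpow_one] at this
      rw [this, mul_comm]
    have term : ∀ u ∈ s, ∫⁻ ω, w u * ξ u ω * (∑ v ∈ s, w v * ξ v ω) ^ (q - 1) ∂P ≤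
        w u * (B * ((B : ℝ≥0∞) ^ (q - 1) * S ^ (q - 1) + C * W ^ (q - 1))
          + C1 * M * W ^ (q - 1)) := by
      intro u hu
      have hR : Measurable fun ω => ∑ v ∈ s.erase u, w v * ξ v ω := by fun_prop
      have hi : IndepFun (fun ω => w u * ξ u ω) (fun ω => ∑ v ∈ s.erase u, w v * ξ v ω) P := by
        have := (hxi.indepFun_finsetSum_of_notMem hxm (Finset.notMem_erase u s)).symm
        convert this using 1
        ext ω; simp
      have h1 := lintegral_mul_add_rpow_le (hxm u) hR hi hr hC1
      have h2 : ∀ ω, w u * ξ u ω + ∑ v ∈ s.erase u, w v * ξ v ω = ∑ v ∈ s, w v * ξ v ω :=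
        fun ω => Finset.add_sum_erase s (fun v => w v * ξ v ω) hu
      simp only [h2] at h1
      refine h1.trans ?_
      have h3 : ∫⁻ ω, (∑ v ∈ s.erase u, w v * ξ v ω) ^ (q - 1) ∂P ≤
          (B : ℝ≥0∞) ^ (q - 1) * S ^ (q - 1) + C * W ^ (q - 1) := by
        refine le_trans (lintegral_mono fun ω => ?_) (hC w s)
        exact ENNReal.rpow_le_rpow (Finset.sum_le_sum_of_subset (Finset.erase_subset _ _)) hr.le
      have h4 : ∫⁻ ω, w u * ξ u ω ∂P ≤ w u * a := by
        rw [lintegral_const_mul _ (hξ u)]; gcongr; exact hmean u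
      have h5 : ∫⁻ ω, (w u * ξ u ω) ^ (q - 1 + 1) ∂P ≤ w u * W ^ (q - 1) * M := by
        rw [sub_add_cancel]
        simp only [ENNReal.mul_rpow_of_nonneg _ _ hq0.le]
        rw [lintegral_const_mul _ (by fun_prop), ← key (w u)]
        gcongr
        · exact Finset.le_sup (f := w) hu
        · exact hmom u
      calc _ ≤ (B / a) * ((w u * a) * ((B : ℝ≥0∞) ^ (q - 1) * S ^ (q - 1) + C * W ^ (q - 1)))
            + C1 * (w u * W ^ (q - 1) * M) := by gcongr
        _ = (B / a * a) * (w u * ((B : ℝ≥0∞) ^ (q - 1) * S ^ (q - 1) + C * W ^ (q - 1)))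
            + C1 * (w u * W ^ (q - 1) * M) := by ring
        _ = _ := by rw [ENNReal.div_mul_cancel ha hatop]; ring
    calc ∫⁻ ω, (∑ u ∈ s, w u * ξ u ω) ^ q ∂P
        = ∫⁻ ω, ∑ u ∈ s, w u * ξ u ω * (∑ v ∈ s, w v * ξ v ω) ^ (q - 1) ∂P := by
          refine lintegral_congr fun ω => ?_
          rw [← Finset.sum_mul, key]
      _ = ∑ u ∈ s, ∫⁻ ω, w u * ξ u ω * (∑ v ∈ s, w v * ξ v ω) ^ (q - 1) ∂P :=
          lintegral_finsetSum _ (by fun_prop)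
      _ ≤ ∑ u ∈ s, w u * (B * ((B : ℝ≥0∞) ^ (q - 1) * S ^ (q - 1) + C * W ^ (q - 1))
          + C1 * M * W ^ (q - 1)) := Finset.sum_le_sum term
      _ = (B * (B : ℝ≥0∞) ^ (q - 1)) * (S * S ^ (q - 1)) + C2 * (S * W ^ (q - 1)) := by
          rw [← Finset.sum_mul, ← hS, hC2]; ring
      _ ≤ (B : ℝ≥0∞) ^ q * S ^ q + C2 * ((A ^ q - (B : ℝ≥0∞) ^ q) / (C2 + 1) * S ^ q
            + C3 * W ^ q) := by
          rw [key, key]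
          have := hC3 S W
          rw [sub_add_cancel] at this
          gcongr
      _ = ((B : ℝ≥0∞) ^ q + C2 * ((A ^ q - (B : ℝ≥0∞) ^ q) / (C2 + 1))) * S ^ q
            + C2 * C3 * W ^ q := by ring
      _ ≤ A ^ q * S ^ q + C2 * C3 * W ^ q := by
          gcongr
          calc _ ≤ (B : ℝ≥0∞) ^ q + (C2 + 1) * ((A ^ q - (B : ℝ≥0∞) ^ q) / (C2 + 1)) := by
                gcongr; exact le_self_add
            _ ≤ (B : ℝ≥0∞) ^ q + (A ^ q - (B : ℝ≥0∞) ^ q) := by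
                gcongr; exact ENNReal.mul_div_le
            _ = A ^ q := add_tsub_cancel_of_le hBA.le

/-- Monotone convergence over finite subsets; the maximum is replaced by `∑' u, w u ^ q`, which
later averages to a Laplace transform at a multiple of the argument. -/
theorem exists_lintegral_tsum_rpow_le [Countable ι] {ξ : ι → Ω → ℝ≥0∞}
    (hξ : ∀ u, Measurable (ξ u)) (hind : iIndepFun ξ P) {a : ℝ≥0∞} (ha : a ≠ 0)
    (hmean : ∀ u, ∫⁻ ω, ξ u ω ∂P ≤ a) {q : ℝ} (hq : 0 < q) {A M : ℝ≥0∞} (hA : a < A)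
    (hAtop : A ≠ ∞) (hM : M ≠ ∞) (hmom : ∀ u, ∫⁻ ω, ξ u ω ^ q ∂P ≤ M) :
    ∃ C : ℝ≥0∞, C ≠ ∞ ∧ ∀ w : ι → ℝ≥0∞,
      ∫⁻ ω, (∑' u, w u * ξ u ω) ^ q ∂P ≤ A ^ q * (∑' u, w u) ^ q + C * ∑' u, w u ^ q := by
  obtain ⟨n, hn⟩ := exists_nat_ge q
  obtain ⟨C, hC, h⟩ := exists_lintegral_sum_rpow_le hξ hind ha hmean n hq (by linarith) hA hAtop
    hM hmom
  refine ⟨C, hC, fun w => ?_⟩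
  have e : ∀ ω, (∑' u, w u * ξ u ω) ^ q = ⨆ s : Finset ι, (∑ u ∈ s, w u * ξ u ω) ^ q := by
    intro ω
    rw [ENNReal.tsum_eq_iSup_sum]
    exact (ENNReal.orderIsoRpow q hq).map_iSup _
  simp only [e]
  rw [lintegral_iSup_directed (fun s => by fun_prop)]
  · refine iSup_le fun s => (h w s).trans ?_
    gcongr
    · exact ENNReal.sum_le_tsum s
    · rw [← ENNReal.le_rpow_inv_iff hq]
      refine Finset.sup_le fun u _ => ?_
      rw [ENNReal.le_rpow_inv_iff hq]
      exact ENNReal.le_tsum u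
  · refine Monotone.directed_le fun s t hst ω => ?_
    exact ENNReal.rpow_le_rpow (Finset.sum_le_sum_of_subset hst) hq.le

end IndependentSums

theorem memLp_ofReal_iff {Ω : Type*} [MeasurableSpace Ω] {P : Measure Ω} {p : ℝ} (hp : 0 < p) {Y : Ω → ℂ} (hY : AEStronglyMeasurable Y P) :
    MemLp Y (ENNReal.ofReal p) P ↔ ∫⁻ ω, ‖Y ω‖ₑ ^ p ∂P < ∞ := by
  rw [MemLp, eLpNorm_lt_top_iff_lintegral_rpow_enorm_lt_top (by simp; linarith) (by simp),
      ENNReal.toReal_ofReal (by linarith)]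
  exact and_iff_right hY

/-! ### Two-sided moment bounds for centred complex sums -/

section CenteredSums

variable {Ω : Type*} [MeasurableSpace Ω] {P : Measure Ω} [IsProbabilityMeasure P] {ι : Type*}

theorem ENNReal.tsum_rpow_le_rpow_tsum {q : ℝ} (hq : 1 ≤ q) (w : ι → ℝ≥0∞) :
    ∑' u, w u ^ q ≤ (∑' u, w u) ^ q := by
  have key : ∀ t : ℝ≥0∞, t * t ^ (q - 1) = t ^ q := fun t => by
    have := ENNReal.rpow_add_of_nonneg (x := t) (q - 1) 1 (by linarith) zero_le_one
    rw [sub_add_cancel, ENNReal.rpow_one] at this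
    rw [this, mul_comm]
  calc ∑' u, w u ^ q = ∑' u, w u * w u ^ (q - 1) := by simp only [key]
    _ ≤ ∑' u, w u * (∑' v, w v) ^ (q - 1) := by
        refine ENNReal.tsum_le_tsum fun u => ?_
        exact mul_le_mul_right (ENNReal.rpow_le_rpow (ENNReal.le_tsum u) (by linarith)) _
    _ = _ := by rw [ENNReal.tsum_mul_right, key]

theorem lintegral_rpow_le_lintegral_rpow_rpow {s p : ℝ} (hs : 0 ≤ s) (hp : 0 < p) (hsp : s ≤ p)
    {f : Ω → ℝ≥0∞} (hf : Measurable f) :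
    ∫⁻ ω, f ω ^ s ∂P ≤ (∫⁻ ω, f ω ^ p ∂P) ^ (s / p) := by
  rcases hs.eq_or_lt with rfl | hs
  · simp
  · refine le_trans (le_of_eq ?_) (lintegral_rpow_le_rpow_lintegral (q := s / p) (by positivity)
      ((div_le_one hp).2 hsp) (f := fun ω => f ω ^ p) (by fun_prop))
    refine lintegral_congr fun ω => ?_
    rw [← ENNReal.rpow_mul, mul_div_cancel₀ _ hp.ne']

theorem enorm_rpow_eq_ofReal {p : ℝ} (hp : 0 ≤ p) (x : ℂ) :
    ‖x‖ₑ ^ p = ENNReal.ofReal (‖x‖ ^ p) := by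
  rw [← ofReal_norm, ENNReal.ofReal_rpow_of_nonneg (norm_nonneg _) hp]

/-- The second order bound is integrated in `y = Y ω`; centring removes the linear term. -/
theorem exists_lintegral_enorm_const_add_rpow_le {p : ℝ} (hp : 2 ≤ p) :
    ∃ C : ℝ≥0∞, C ≠ ∞ ∧ ∀ (x : ℂ) {Y : Ω → ℂ}, Measurable Y → ∫⁻ ω, ‖Y ω‖ₑ ^ p ∂P ≠ ∞ →
      ∫ ω, Y ω ∂P = 0 → ∫⁻ ω, ‖x + Y ω‖ₑ ^ p ∂P ≤ ‖x‖ₑ ^ p +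
        C * (‖x‖ₑ ^ (p - 2) * ∫⁻ ω, ‖Y ω‖ₑ ^ 2 ∂P + ∫⁻ ω, ‖Y ω‖ₑ ^ p ∂P) := by
  obtain ⟨C, hC, h⟩ := Complex.exists_norm_add_rpow_le hp
  refine ⟨ENNReal.ofReal C, by simp, fun x Y hY hYp hY0 => ?_⟩
  have hL : MemLp Y (ENNReal.ofReal p) P := by
    refine ⟨hY.aestronglyMeasurable, ?_⟩
    rw [eLpNorm_lt_top_iff_lintegral_rpow_enorm_lt_top (by simp; linarith) (by simp),
      ENNReal.toReal_ofReal (by linarith)]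
    exact hYp.lt_top
  have hL2 : MemLp Y 2 P := hL.mono_exponent (by
    rw [← ENNReal.ofReal_ofNat]; exact ENNReal.ofReal_le_ofReal hp)
  have hL1 : Integrable Y P := hL2.integrable (by norm_num)
  have i2 : Integrable (fun ω => ‖Y ω‖ ^ 2) P := hL2.integrable_norm_pow (by norm_num)
  have ip : Integrable (fun ω => ‖Y ω‖ ^ p) P := by
    have := hL.integrable_norm_rpow (by simp; linarith) (by simp)
    rwa [ENNReal.toReal_ofReal (by linarith)] at this
  have ic : Integrable (fun ω => ((starRingEnd ℂ) x * Y ω).re) P :=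
    (hL1.const_mul _).re
  have h0 : ∫ ω, ((starRingEnd ℂ) x * Y ω).re ∂P = 0 := by
    have e := integral_re (𝕜 := ℂ) (hL1.const_mul ((starRingEnd ℂ) x))
    rw [integral_const_mul, hY0] at e
    simpa using e
  set g : Ω → ℝ := fun ω => ‖x‖ ^ p + p * ‖x‖ ^ (p - 2) * ((starRingEnd ℂ) x * Y ω).re
      + C * (‖x‖ ^ (p - 2) * ‖Y ω‖ ^ 2 + ‖Y ω‖ ^ p) with hg
  have ig1 : Integrable (fun ω => ‖x‖ ^ p + p * ‖x‖ ^ (p - 2) * ((starRingEnd ℂ) x * Y ω).re) P :=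
    (integrable_const _).add (ic.const_mul _)
  have ig2 : Integrable (fun ω => ‖x‖ ^ (p - 2) * ‖Y ω‖ ^ 2 + ‖Y ω‖ ^ p) P :=
    (i2.const_mul _).add ip
  have ig : Integrable g P := ig1.add (ig2.const_mul _)
  have hint : ∫ ω, g ω ∂P = ‖x‖ ^ p + C * (‖x‖ ^ (p - 2) * ∫ ω, ‖Y ω‖ ^ 2 ∂P
      + ∫ ω, ‖Y ω‖ ^ p ∂P) := by
    rw [hg, integral_add ig1 (ig2.const_mul _), integral_add (integrable_const _) (ic.const_mul _),
      integral_const_mul, h0, integral_const_mul, integral_add (i2.const_mul _) ip,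
      integral_const_mul]
    simp
  have hp0 : 0 ≤ p := by linarith
  calc ∫⁻ ω, ‖x + Y ω‖ₑ ^ p ∂P ≤ ∫⁻ ω, ENNReal.ofReal (g ω) ∂P := by
        refine lintegral_mono fun ω => ?_
        rw [enorm_rpow_eq_ofReal hp0]
        exact ENNReal.ofReal_le_ofReal (h x (Y ω))
    _ = ENNReal.ofReal (∫ ω, g ω ∂P) := by
        rw [ofReal_integral_eq_lintegral_ofReal ig]
        exact Eventually.of_forall fun ω =>
          (Real.rpow_nonneg (norm_nonneg _) p).trans (h x (Y ω))
    _ = _ := by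
        have n1 : 0 ≤ ∫ ω, ‖Y ω‖ ^ 2 ∂P := integral_nonneg fun ω => by positivity
        have n2 : 0 ≤ ∫ ω, ‖Y ω‖ ^ p ∂P := integral_nonneg fun ω => by positivity
        have e2 : ∫⁻ ω, ‖Y ω‖ₑ ^ 2 ∂P = ENNReal.ofReal (∫ ω, ‖Y ω‖ ^ 2 ∂P) := by
          rw [ofReal_integral_eq_lintegral_ofReal i2 (Eventually.of_forall fun ω => by positivity)]
          refine lintegral_congr fun ω => ?_
          rw [← ofReal_norm, ENNReal.ofReal_pow (norm_nonneg _)]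
        have ep : ∫⁻ ω, ‖Y ω‖ₑ ^ p ∂P = ENNReal.ofReal (∫ ω, ‖Y ω‖ ^ p ∂P) := by
          rw [ofReal_integral_eq_lintegral_ofReal ip (Eventually.of_forall fun ω => by positivity)]
          exact lintegral_congr fun ω => enorm_rpow_eq_ofReal hp0 _
        rw [hint, e2, ep, enorm_rpow_eq_ofReal hp0, enorm_rpow_eq_ofReal (by linarith),
          ← ENNReal.ofReal_mul (by positivity), ← ENNReal.ofReal_add (by positivity) n2,
          ← ENNReal.ofReal_mul hC, ← ENNReal.ofReal_add (by positivity) (by positivity)]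

theorem lintegral_enorm_const_add_sq (x : ℂ) {Y : Ω → ℂ} (hY : MemLp Y 2 P)
    (hY0 : ∫ ω, Y ω ∂P = 0) :
    ∫⁻ ω, ‖x + Y ω‖ₑ ^ 2 ∂P = ‖x‖ₑ ^ 2 + ∫⁻ ω, ‖Y ω‖ₑ ^ 2 ∂P := by
  have hL1 : Integrable Y P := hY.integrable (by norm_num)
  have hxY : MemLp (fun ω => x + Y ω) 2 P := (memLp_const x).add hY
  have ic : Integrable (fun ω => 2 * ((starRingEnd ℂ) x * Y ω).re) P :=
    (hL1.const_mul _).re.const_mul 2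
  have h0 : ∫ ω, ((starRingEnd ℂ) x * Y ω).re ∂P = 0 := by
    have e := integral_re (𝕜 := ℂ) (hL1.const_mul ((starRingEnd ℂ) x))
    rw [integral_const_mul, hY0] at e
    simpa using e
  have conv : ∀ {Z : Ω → ℂ}, MemLp Z 2 P →
      ∫⁻ ω, ‖Z ω‖ₑ ^ 2 ∂P = ENNReal.ofReal (∫ ω, ‖Z ω‖ ^ 2 ∂P) := by
    intro Z hZ
    rw [ofReal_integral_eq_lintegral_ofReal (hZ.integrable_norm_pow (by norm_num))
      (Eventually.of_forall fun ω => by positivity)]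
    refine lintegral_congr fun ω => ?_
    rw [← ofReal_norm, ENNReal.ofReal_pow (norm_nonneg _)]
  have i2 : Integrable (fun ω => ‖Y ω‖ ^ 2) P := hY.integrable_norm_pow (by norm_num)
  have e : ∀ ω, ‖x + Y ω‖ ^ 2 = ‖x‖ ^ 2 + 2 * ((starRingEnd ℂ) x * Y ω).re + ‖Y ω‖ ^ 2 := by
    intro ω
    rw [Complex.sq_norm, Complex.sq_norm, Complex.sq_norm, Complex.normSq_add]
    simp [Complex.mul_re]; ring
  rw [conv hxY, conv hY, ← ofReal_norm, ← ENNReal.ofReal_pow (norm_nonneg _),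
    ← ENNReal.ofReal_add (by positivity) (integral_nonneg fun ω => by positivity)]
  congr 1
  simp only [e]
  have i3 : Integrable (fun ω => ‖x‖ ^ 2 + 2 * ((starRingEnd ℂ) x * Y ω).re) P :=
    (integrable_const _).add ic
  rw [integral_add i3 i2, integral_add (integrable_const _) ic,
    integral_const_mul, h0]
  simp

/-- The constant in the induction for `exists_lintegral_enorm_sum_rpow_le`. -/
theorem ENNReal.exists_rpow_absorb {p : ℝ} (hp : 2 ≤ p) {C M N : ℝ≥0∞} (hC : C ≠ ∞) (hM : M ≠ ∞)
    (hN : N ≠ ∞) : ∃ L : ℝ≥0∞, L ≠ ∞ ∧ ∀ B b : ℝ≥0∞,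
      L * B ^ (p / 2) + C * ((L * B ^ (p / 2)) ^ ((p - 2) / p) * (b * N) + b ^ (p / 2) * M)
        ≤ L * (B + b) ^ (p / 2) := by
  -- `K` is large enough that each of the two error terms, taken with `L = 2 * K`, is at most `K * b
  -- * (B + b) ^ (p / 2 - 1)`. This is possible because `L` enters the error with power `(p - 2) / p
  -- < 1`.
  set K : ℝ≥0∞ := 1 + C * M + (2 * (C * N)) ^ (p / 2) with hK
  have hs0 : 0 ≤ (p - 2) / p := div_nonneg (by linarith) (by linarith)
  have hs1 : (p - 2) / p ≤ 1 := (div_le_one (by linarith)).2 (by linarith)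
  have hKtop : K ≠ ∞ := by
    rw [hK]
    refine ENNReal.add_ne_top.2 ⟨ENNReal.add_ne_top.2 ⟨by simp, ENNReal.mul_ne_top hC hM⟩, ?_⟩
    exact ENNReal.rpow_ne_top_of_nonneg (by linarith)
      (ENNReal.mul_ne_top (by simp) (ENNReal.mul_ne_top hC hN))
  have hK0 : K ≠ 0 := by
    have : (1 : ℝ≥0∞) ≤ K := by rw [hK, add_assoc]; exact le_self_add
    exact (zero_lt_one.trans_le this).ne'
  have hCM : C * M ≤ K := by
    rw [hK]; exact le_add_right (le_add_left le_rfl)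
  have hCN : C * (2 * K) ^ ((p - 2) / p) * N ≤ K := by
    have h1 : 2 * (C * N) ≤ K ^ (2 / p) := by
      have : (p / 2)⁻¹ = 2 / p := by rw [inv_div]
      rw [← this, ENNReal.le_rpow_inv_iff (by linarith), hK]
      exact le_add_left le_rfl
    calc C * (2 * K) ^ ((p - 2) / p) * N ≤ C * (2 * K ^ ((p - 2) / p)) * N := by
          gcongr
          rw [ENNReal.mul_rpow_of_nonneg _ _ hs0]
          gcongr
          calc (2 : ℝ≥0∞) ^ ((p - 2) / p) ≤ 2 ^ (1 : ℝ) :=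
                ENNReal.rpow_le_rpow_of_exponent_le (by norm_num) hs1
            _ = 2 := ENNReal.rpow_one _
      _ = (2 * (C * N)) * K ^ ((p - 2) / p) := by ring
      _ ≤ K ^ (2 / p) * K ^ ((p - 2) / p) := by gcongr
      _ = K := by
          rw [← ENNReal.rpow_add _ _ hK0 hKtop, ← add_div, add_sub_cancel,
            div_self (by linarith), ENNReal.rpow_one]
  refine ⟨2 * K, ENNReal.mul_ne_top (by simp) hKtop, fun B b => ?_⟩
  have hr : 0 ≤ p / 2 - 1 := by linarith
  have key : ∀ t : ℝ≥0∞, t * t ^ (p / 2 - 1) = t ^ (p / 2) := fun t => by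
    have := ENNReal.rpow_add_of_nonneg (x := t) (p / 2 - 1) 1 hr zero_le_one
    rw [sub_add_cancel, ENNReal.rpow_one] at this
    rw [this, mul_comm]
  have e1 : (2 * K * B ^ (p / 2)) ^ ((p - 2) / p) =
      (2 * K) ^ ((p - 2) / p) * B ^ (p / 2 - 1) := by
    rw [ENNReal.mul_rpow_of_nonneg _ _ hs0, ← ENNReal.rpow_mul]
    congr 2
    field_simp
  calc _ = 2 * K * B ^ (p / 2) + (C * (2 * K) ^ ((p - 2) / p) * N) * (b * B ^ (p / 2 - 1))
        + C * M * b ^ (p / 2) := by rw [e1]; ring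
    _ ≤ 2 * K * (B * (B + b) ^ (p / 2 - 1)) + K * (b * (B + b) ^ (p / 2 - 1))
        + K * (b * (B + b) ^ (p / 2 - 1)) := by
        rw [← key B, ← key b]
        gcongr
        · exact le_self_add
        · exact le_self_add
        · exact le_add_self
    _ = 2 * K * ((B + b) * (B + b) ^ (p / 2 - 1)) := by ring
    _ = _ := by rw [key]

/-- Summands are added one at a time: with the previous partial sum `S` frozen, the increment bound
applies, and Jensen controls `E ‖S‖ ^ (p - 2)` by the induction hypothesis. The constant `L` from
`ENNReal.exists_rpow_absorb` is reproduced at each insertion. -/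
theorem exists_lintegral_enorm_sum_rpow_le {p : ℝ} (hp : 2 ≤ p) {ξ : ι → Ω → ℂ}
    (hξ : ∀ u, Measurable (ξ u)) (hind : iIndepFun ξ P) (hmean : ∀ u, ∫ ω, ξ u ω ∂P = 0)
    {M : ℝ≥0∞} (hM : M ≠ ∞) (hmom : ∀ u, ∫⁻ ω, ‖ξ u ω‖ₑ ^ p ∂P ≤ M) :
    ∃ L : ℝ≥0∞, L ≠ ∞ ∧ ∀ (c : ι → ℂ) (s : Finset ι),
      ∫⁻ ω, ‖∑ u ∈ s, c u * ξ u ω‖ₑ ^ p ∂P ≤ L * (∑ u ∈ s, ‖c u‖ₑ ^ 2) ^ (p / 2) := by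
  classical
  obtain ⟨C, hC, hstep⟩ := exists_lintegral_enorm_const_add_rpow_le (P := P) hp
  obtain ⟨L, hL, habs⟩ := ENNReal.exists_rpow_absorb hp hC hM
    (ENNReal.add_ne_top.2 ⟨ENNReal.one_ne_top, hM⟩)
  have hp0 : 0 < p := by linarith
  have hmom2 : ∀ u, ∫⁻ ω, ‖ξ u ω‖ₑ ^ 2 ∂P ≤ 1 + M := fun u => by
    calc ∫⁻ ω, ‖ξ u ω‖ₑ ^ 2 ∂P ≤ ∫⁻ ω, (1 + ‖ξ u ω‖ₑ ^ p) ∂P := lintegral_mono fun ω => by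
            rw [← ENNReal.rpow_two]
            exact ENNReal.rpow_le_one_add_rpow (by norm_num) hp _
      _ = 1 + ∫⁻ ω, ‖ξ u ω‖ₑ ^ p ∂P := by rw [lintegral_add_left measurable_const]; simp
      _ ≤ 1 + M := by gcongr; exact hmom u
  refine ⟨L, hL, fun c s => ?_⟩
  have hxm : ∀ u, Measurable fun ω => c u * ξ u ω := fun u => (hξ u).const_mul _
  have hxi : iIndepFun (fun u ω => c u * ξ u ω) P :=
    hind.comp (fun u t => c u * t) (fun u => measurable_const_mul _)
  induction s using Finset.induction_on with
  | empty => simp [hp0]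
  | insert k s hk ih =>
    set S : Ω → ℂ := fun ω => ∑ u ∈ s, c u * ξ u ω with hS
    have hSm : Measurable S := by fun_prop
    have hi : IndepFun S (fun ω => c k * ξ k ω) P := by
      have := hxi.indepFun_finsetSum_of_notMem hxm hk
      convert this using 1
      ext ω; simp [hS]
    have hF : Measurable fun q : ℂ × ℂ => ‖q.1 + q.2‖ₑ ^ p := by fun_prop
    have h1 := lintegral_comp_prodMk_of_indepFun hSm (hxm k) hi hF
    have hcp : ∫⁻ ω, ‖c k * ξ k ω‖ₑ ^ p ∂P ≤ (‖c k‖ₑ ^ 2) ^ (p / 2) * M := by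
      simp only [enorm_mul, ENNReal.mul_rpow_of_nonneg _ _ hp0.le]
      rw [lintegral_const_mul _ (by fun_prop), ← ENNReal.rpow_two, ← ENNReal.rpow_mul,
        mul_div_cancel₀ _ (by norm_num)]
      gcongr
      exact hmom k
    have hc2 : ∫⁻ ω, ‖c k * ξ k ω‖ₑ ^ 2 ∂P ≤ ‖c k‖ₑ ^ 2 * (1 + M) := by
      simp only [enorm_mul, mul_pow]
      rw [lintegral_const_mul _ (by fun_prop)]
      gcongr
      exact hmom2 k
    have hne : ∫⁻ ω, ‖c k * ξ k ω‖ₑ ^ p ∂P ≠ ∞ := by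
      refine (hcp.trans_lt ?_).ne
      exact ENNReal.mul_lt_top (ENNReal.rpow_lt_top_of_nonneg (by linarith) (by simp)) hM.lt_top
    simp only [Finset.sum_insert hk]
    calc ∫⁻ ω, ‖c k * ξ k ω + ∑ u ∈ s, c u * ξ u ω‖ₑ ^ p ∂P
        = ∫⁻ ω, ‖S ω + c k * ξ k ω‖ₑ ^ p ∂P := by simp only [hS, add_comm]
      _ = ∫⁻ ω, ∫⁻ ω', ‖S ω + c k * ξ k ω'‖ₑ ^ p ∂P ∂P := h1
      _ ≤ ∫⁻ ω, (‖S ω‖ₑ ^ p + C * (‖S ω‖ₑ ^ (p - 2) * (‖c k‖ₑ ^ 2 * (1 + M))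
            + (‖c k‖ₑ ^ 2) ^ (p / 2) * M)) ∂P := by
          refine lintegral_mono fun ω => ?_
          refine (hstep (S ω) (hxm k) hne (by rw [integral_const_mul, hmean, mul_zero])).trans ?_
          gcongr
      _ = ∫⁻ ω, ‖S ω‖ₑ ^ p ∂P + C * ((∫⁻ ω, ‖S ω‖ₑ ^ (p - 2) ∂P) * (‖c k‖ₑ ^ 2 * (1 + M))
            + (‖c k‖ₑ ^ 2) ^ (p / 2) * M) := by
          rw [lintegral_add_left (by fun_prop), lintegral_const_mul _ (by fun_prop),
            lintegral_add_right _ measurable_const, lintegral_mul_const _ (by fun_prop)]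
          simp
      _ ≤ L * (∑ u ∈ s, ‖c u‖ₑ ^ 2) ^ (p / 2)
          + C * ((L * (∑ u ∈ s, ‖c u‖ₑ ^ 2) ^ (p / 2)) ^ ((p - 2) / p) * (‖c k‖ₑ ^ 2 * (1 + M))
            + (‖c k‖ₑ ^ 2) ^ (p / 2) * M) := by
          have h2 := lintegral_rpow_le_lintegral_rpow_rpow (P := P) (by linarith : 0 ≤ p - 2) hp0
            (by linarith) (f := fun ω => ‖S ω‖ₑ) (by fun_prop)
          have h3 := h2.trans (ENNReal.rpow_le_rpow ih (div_nonneg (by linarith) hp0.le))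
          gcongr
      _ ≤ L * (∑ u ∈ s, ‖c u‖ₑ ^ 2 + ‖c k‖ₑ ^ 2) ^ (p / 2) := habs _ _
      _ = _ := by rw [add_comm]

/-- Fatou's lemma along a sequence of finite sets that exhausts `ι`. -/
theorem exists_lintegral_enorm_tsum_rpow_le [Countable ι] {p : ℝ} (hp : 2 ≤ p) {ξ : ι → Ω → ℂ}
    (hξ : ∀ u, Measurable (ξ u)) (hind : iIndepFun ξ P) (hmean : ∀ u, ∫ ω, ξ u ω ∂P = 0)
    {M : ℝ≥0∞} (hM : M ≠ ∞) (hmom : ∀ u, ∫⁻ ω, ‖ξ u ω‖ₑ ^ p ∂P ≤ M) :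
    ∃ L : ℝ≥0∞, L ≠ ∞ ∧ ∀ c : ι → ℂ,
      ∫⁻ ω, ‖∑' u, c u * ξ u ω‖ₑ ^ p ∂P ≤ L * (∑' u, ‖c u‖ₑ ^ 2) ^ (p / 2) := by
  obtain ⟨L, hL, h⟩ := exists_lintegral_enorm_sum_rpow_le hp hξ hind hmean hM hmom
  have hp0 : 0 < p := by linarith
  refine ⟨L, hL, fun c => ?_⟩
  obtain ⟨s, hs⟩ := exists_seq_tendsto (atTop : Filter (Finset ι))
  calc ∫⁻ ω, ‖∑' u, c u * ξ u ω‖ₑ ^ p ∂P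
      ≤ ∫⁻ ω, liminf (fun n => ‖∑ u ∈ s n, c u * ξ u ω‖ₑ ^ p) atTop ∂P := by
        refine lintegral_mono fun ω => ?_
        by_cases hsum : Summable fun u => c u * ξ u ω
        · have h1 : Tendsto (fun n => ‖∑ u ∈ s n, c u * ξ u ω‖ₑ ^ p) atTop
              (𝓝 (‖∑' u, c u * ξ u ω‖ₑ ^ p)) :=
            ((ENNReal.continuous_rpow_const.comp continuous_enorm).tendsto _).comp
              (hsum.hasSum.comp hs)
          exact h1.liminf_eq.ge
        -- Where the series is not summable, `∑'` has the value `0` and the inequality is trivial.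
        · rw [tsum_eq_zero_of_not_summable hsum]
          simp [hp0]
    _ ≤ liminf (fun n => ∫⁻ ω, ‖∑ u ∈ s n, c u * ξ u ω‖ₑ ^ p ∂P) atTop :=
        lintegral_liminf_le fun n => by fun_prop
    _ ≤ liminf (fun _ : ℕ => L * (∑' u, ‖c u‖ₑ ^ 2) ^ (p / 2)) atTop := by
        refine liminf_le_liminf (Eventually.of_forall fun n => (h c (s n)).trans ?_)
        gcongr
        exact ENNReal.sum_le_tsum _
    _ = _ := liminf_const _

theorem lintegral_enorm_sum_sq {ξ : ι → Ω → ℂ} (hξ : ∀ u, Measurable (ξ u))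
    (hind : iIndepFun ξ P) (hmean : ∀ u, ∫ ω, ξ u ω ∂P = 0) {v : ℝ≥0∞} (hv : v ≠ ∞)
    (hvar : ∀ u, ∫⁻ ω, ‖ξ u ω‖ₑ ^ 2 ∂P = v) (c : ι → ℂ) (s : Finset ι) :
    ∫⁻ ω, ‖∑ u ∈ s, c u * ξ u ω‖ₑ ^ 2 ∂P = v * ∑ u ∈ s, ‖c u‖ₑ ^ 2 := by
  classical
  have hxm : ∀ u, Measurable fun ω => c u * ξ u ω := fun u => (hξ u).const_mul _
  have hxi : iIndepFun (fun u ω => c u * ξ u ω) P :=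
    hind.comp (fun u t => c u * t) (fun u => measurable_const_mul _)
  induction s using Finset.induction_on with
  | empty => simp
  | insert k s hk ih =>
    set S : Ω → ℂ := fun ω => ∑ u ∈ s, c u * ξ u ω with hS
    have hSm : Measurable S := by fun_prop
    have hi : IndepFun S (fun ω => c k * ξ k ω) P := by
      have := hxi.indepFun_finsetSum_of_notMem hxm hk
      convert this using 1
      ext ω; simp [hS]
    have hF : Measurable fun q : ℂ × ℂ => ‖q.1 + q.2‖ₑ ^ 2 := by fun_prop
    have h1 := lintegral_comp_prodMk_of_indepFun hSm (hxm k) hi hF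
    have hc2 : ∫⁻ ω, ‖c k * ξ k ω‖ₑ ^ 2 ∂P = v * ‖c k‖ₑ ^ 2 := by
      simp only [enorm_mul, mul_pow]
      rw [lintegral_const_mul _ (by fun_prop), hvar, mul_comm]
    have hLp : MemLp (fun ω => c k * ξ k ω) 2 P := by
      rw [← ENNReal.ofReal_ofNat, memLp_ofReal_iff (by norm_num) (hxm k).aestronglyMeasurable]
      simp only [ENNReal.rpow_two, hc2]
      exact ENNReal.mul_lt_top hv.lt_top (by simp)
    simp only [Finset.sum_insert hk]
    calc ∫⁻ ω, ‖c k * ξ k ω + ∑ u ∈ s, c u * ξ u ω‖ₑ ^ 2 ∂P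
        = ∫⁻ ω, ‖S ω + c k * ξ k ω‖ₑ ^ 2 ∂P := by simp only [hS, add_comm]
      _ = ∫⁻ ω, ∫⁻ ω', ‖S ω + c k * ξ k ω'‖ₑ ^ 2 ∂P ∂P := h1
      _ = ∫⁻ ω, (‖S ω‖ₑ ^ 2 + v * ‖c k‖ₑ ^ 2) ∂P := by
          refine lintegral_congr fun ω => ?_
          rw [lintegral_enorm_const_add_sq _ hLp (by rw [integral_const_mul, hmean, mul_zero]), hc2]
      _ = _ := by
          rw [lintegral_add_right _ measurable_const, ih]
          simp; ring

/-- Jensen reduces the `p`-th moment to the second, which orthogonality computes exactly. Absolute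
summability of `c` supplies the dominating function for passing from finite sums to the series. -/
theorem le_lintegral_enorm_tsum_rpow [Countable ι] {p : ℝ} (hp : 2 ≤ p) {ξ : ι → Ω → ℂ}
    (hξ : ∀ u, Measurable (ξ u)) (hind : iIndepFun ξ P) (hmean : ∀ u, ∫ ω, ξ u ω ∂P = 0)
    {v : ℝ≥0∞} (hv : v ≠ ∞) (hvar : ∀ u, ∫⁻ ω, ‖ξ u ω‖ₑ ^ 2 ∂P = v) {c : ι → ℂ}
    (hc : ∑' u, ‖c u‖ₑ ≠ ∞) :
    (v * ∑' u, ‖c u‖ₑ ^ 2) ^ (p / 2) ≤ ∫⁻ ω, ‖∑' u, c u * ξ u ω‖ₑ ^ p ∂P := by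
  have hdom : ∫⁻ ω, (∑' u, ‖c u‖ₑ * ‖ξ u ω‖ₑ) ^ (2 : ℝ) ∂P ≠ ∞ := by
    obtain ⟨C, hC, h⟩ := exists_lintegral_tsum_rpow_le (P := P) (ξ := fun u ω => ‖ξ u ω‖ₑ)
      (fun u => by fun_prop) (hind.comp (fun _ t => ‖t‖ₑ) (fun _ => measurable_enorm))
      (a := 1 + v) (by simp) (fun u => by
        calc ∫⁻ ω, ‖ξ u ω‖ₑ ∂P ≤ ∫⁻ ω, (1 + ‖ξ u ω‖ₑ ^ 2) ∂P := lintegral_mono fun ω => by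
              have := ENNReal.rpow_le_one_add_rpow (s := 1) (r := 2) (by norm_num) (by norm_num)
                ‖ξ u ω‖ₑ
              simpa using this
          _ = 1 + v := by rw [lintegral_add_left measurable_const, hvar]; simp)
      (q := 2) (by norm_num) (A := 1 + v + 1) (M := v)
      (ENNReal.lt_add_right (by simpa using hv) one_ne_zero) (by simpa using hv) hv
      (fun u => by simpa using (hvar u).le)
    refine ((h fun u => ‖c u‖ₑ).trans_lt ?_).ne
    have h1 := ENNReal.tsum_rpow_le_rpow_tsum (q := 2) (by norm_num) fun u => ‖c u‖ₑ
    have h2 : (∑' u, ‖c u‖ₑ) ^ (2 : ℝ) ≠ ∞ := ENNReal.rpow_ne_top_of_nonneg (by norm_num) hc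
    refine ENNReal.add_lt_top.2 ⟨ENNReal.mul_lt_top ?_ h2.lt_top,
      ENNReal.mul_lt_top hC.lt_top (h1.trans_lt h2.lt_top)⟩
    exact ENNReal.rpow_lt_top_of_nonneg (by norm_num) (by simpa using hv)
  have hae : ∀ᵐ ω ∂P, Summable fun u => c u * ξ u ω := by
    have hm : Measurable fun ω => (∑' u, ‖c u‖ₑ * ‖ξ u ω‖ₑ) ^ (2 : ℝ) :=
      (Measurable.tsum fun u => by fun_prop).pow_const _
    filter_upwards [ae_lt_top hm hdom] with ω hω
    have : ∑' u, ‖c u * ξ u ω‖ₑ ≠ ∞ := by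
      simp only [enorm_mul]
      intro h
      rw [h] at hω
      simp at hω
    exact Summable.of_norm (by
      have := ENNReal.summable_toReal this
      simpa using this)
  have hlim : v * ∑' u, ‖c u‖ₑ ^ 2 = ∫⁻ ω, ‖∑' u, c u * ξ u ω‖ₑ ^ 2 ∂P := by
    refine tendsto_nhds_unique (f := fun s : Finset ι => ∫⁻ ω, ‖∑ u ∈ s, c u * ξ u ω‖ₑ ^ 2 ∂P)
      (l := atTop) ?_ ?_
    · simp only [lintegral_enorm_sum_sq hξ hind hmean hv hvar]
      exact ENNReal.Tendsto.const_mul ENNReal.summable.hasSum (Or.inr hv)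
    · refine tendsto_lintegral_filter_of_dominated_convergence
        (fun ω => (∑' u, ‖c u‖ₑ * ‖ξ u ω‖ₑ) ^ (2 : ℝ))
        (Eventually.of_forall fun s => by fun_prop)
        (Eventually.of_forall fun s => Eventually.of_forall fun ω => ?_) hdom ?_
      · rw [ENNReal.rpow_two]
        gcongr
        refine (enorm_sum_le _ _).trans ?_
        simp only [enorm_mul]
        exact ENNReal.sum_le_tsum s
      · filter_upwards [hae] with ω hω
        exact (((ENNReal.continuous_pow 2).comp continuous_enorm).tendsto _).comp hω.hasSum
  rw [hlim]
  refine (rpow_lintegral_le_lintegral_rpow (by linarith) ?_).trans (le_of_eq ?_)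
  · exact (Measurable.tsum fun u => by fun_prop).enorm.pow_const _
  · refine lintegral_congr fun ω => ?_
    rw [← ENNReal.rpow_two, ← ENNReal.rpow_mul, mul_div_cancel₀ _ (by norm_num)]

end CenteredSums

/-! ### Generations of a branching random walk -/

/-- On the measurable set of measures for which `f` is integrable, the Bochner integral is a
combination of four nonnegative integrals; elsewhere it is `0` by convention. -/
theorem measurable_integral_measure {α : Type*} [MeasurableSpace α] {f : α → ℂ}
    (hf : Measurable f) : Measurable fun μ : Measure α => ∫ x, f x ∂μ := by
  classical
  have e : (fun μ : Measure α => ∫ x, f x ∂μ) = fun μ : Measure α =>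
      if ∫⁻ x, ‖f x‖ₑ ∂μ < ∞ then
        (((∫⁻ x, ENNReal.ofReal (f x).re ∂μ).toReal
          - (∫⁻ x, ENNReal.ofReal (-(f x).re) ∂μ).toReal : ℝ) : ℂ)
        + (((∫⁻ x, ENNReal.ofReal (f x).im ∂μ).toReal
          - (∫⁻ x, ENNReal.ofReal (-(f x).im) ∂μ).toReal : ℝ) : ℂ) * Complex.I
      else 0 := by
    ext1 μ
    split_ifs with h
    · have hi : Integrable f μ := ⟨hf.aestronglyMeasurable, h⟩
      have h1 := integral_eq_lintegral_pos_part_sub_lintegral_neg_part hi.re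
      have h2 := integral_eq_lintegral_pos_part_sub_lintegral_neg_part hi.im
      simp only [RCLike.re_to_complex, RCLike.im_to_complex] at h1 h2
      rw [← h1, ← h2]
      exact (integral_re_add_im (𝕜 := ℂ) hi).symm
    · exact integral_undef fun hi => h hi.2
  rw [e]
  have m1 : ∀ g : α → ℝ≥0∞, Measurable g → Measurable fun μ : Measure α => ∫⁻ x, g x ∂μ :=
    fun g hg => Measure.measurable_lintegral hg
  have h1 := m1 _ hf.enorm
  have h2 := m1 (fun x => ENNReal.ofReal (f x).re) (by fun_prop)
  have h3 := m1 (fun x => ENNReal.ofReal (-(f x).re)) (by fun_prop)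
  have h4 := m1 (fun x => ENNReal.ofReal (f x).im) (by fun_prop)
  have h5 := m1 (fun x => ENNReal.ofReal (-(f x).im)) (by fun_prop)
  exact Measurable.ite (measurableSet_lt h1 measurable_const) (by fun_prop) measurable_const

theorem integral_sum_ite_dirac {ι : Type*} [Countable ι] (c : ι → Prop) [DecidablePred c]
    (x : ι → ℝ) (f : ℝ → ℂ) :
    ∫ y, f y ∂(Measure.sum fun i => if c i then Measure.dirac (x i) else 0) =
      ∑' i, if c i then f (x i) else 0 := by
  have e : (fun i => if c i then Measure.dirac (x i) else 0) =
      fun i => (if c i then (1 : ℝ≥0∞) else 0) • Measure.dirac (x i) := by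
    ext1 i; split_ifs <;> simp
  rw [e, integral_sum_dirac (fun i => by split_ifs <;> simp)]
  refine tsum_congr fun i => ?_
  split_ifs <;> simp

theorem lintegral_sum_ite_dirac {ι : Type*} (c : ι → Prop) [DecidablePred c]
    (x : ι → ℝ) (f : ℝ → ℝ≥0∞) :
    ∫⁻ y, f y ∂(Measure.sum fun i => if c i then Measure.dirac (x i) else 0) =
      ∑' i, if c i then f (x i) else 0 := by
  rw [lintegral_sum_measure]
  refine tsum_congr fun i => ?_
  split_ifs <;> simp

theorem measurableSet_natCast_lt {α : Type*} [MeasurableSpace α] {f : α → ℕ∞}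
    (hf : Measurable f) (i : ℕ) : MeasurableSet {a | (i : ℕ∞) < f a} :=
  hf (MeasurableSet.of_discrete (s := Set.Ioi (i : ℕ∞)))

theorem measurable_pointConfiguration :
    Measurable fun d : ℕ∞ × (ℕ → ℝ) => pointConfiguration d.1 d.2 := by
  classical
  refine Measure.measurable_of_measurable_coe _ fun s hs => ?_
  simp only [pointConfiguration, Measure.sum_apply _ hs]
  refine Measurable.tsum fun i => ?_
  have e : (fun d : ℕ∞ × (ℕ → ℝ) =>
      (if (i : ℕ∞) < d.1 then Measure.dirac (d.2 i) else 0 : Measure ℝ) s) =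
      fun d => if (i : ℕ∞) < d.1 then s.indicator 1 (d.2 i) else 0 := by
    ext1 d
    split_ifs
    · rw [Measure.dirac_apply' _ hs]
    · simp
  rw [e]
  refine Measurable.ite (measurableSet_natCast_lt measurable_fst i) ?_ measurable_const
  exact (measurable_one.indicator hs).comp ((measurable_pi_apply i).comp measurable_snd)

namespace BranchingRandomWalk

variable {Ω : Type*} [MeasurableSpace Ω] {P : Measure Ω} (B : BranchingRandomWalk P)

open Classical in
/-- The number of children of an individual and their displacements, set to `0` where no child
is born. -/
def offspring (u : List ℕ) (ω : Ω) : ℕ∞ × (ℕ → ℝ) :=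
  (B.J u ω, fun i => if (i : ℕ∞) < B.J u ω then B.X u i ω else 0)

/-- The point process of the displacements of the children of `u`. -/
def litter (u : List ℕ) (ω : Ω) : Measure ℝ :=
  pointConfiguration (B.J u ω) (fun i => B.X u i ω)

open Classical in
/-- The contribution of the individual `u` to the exponential sum over generation `n`. -/
def weight (n : ℕ) (z : ℂ) (u : List ℕ) (ω : Ω) : ℂ :=
  if u.length = n ∧ B.Born u ω then Complex.exp (-z * B.S u ω) else 0

open Classical in
/-- The contribution of the individual `u` to the real exponential sum over generation `n`. -/
def realWeight (n : ℕ) (t : ℝ) (u : List ℕ) (ω : Ω) : ℝ≥0∞ :=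
  if u.length = n ∧ B.Born u ω then ENNReal.ofReal (Real.exp (-t * B.S u ω)) else 0

/-- The exponential sum over generation `n` at a real argument. -/
def realSum (n : ℕ) (t : ℝ) (ω : Ω) : ℝ≥0∞ := ∑' u, B.realWeight n t u ω

/-- The Laplace transform of a point configuration at a real argument. -/
def realLaplace (t : ℝ) (μ : Measure ℝ) : ℝ≥0∞ :=
  ∫⁻ x, ENNReal.ofReal (Real.exp (-t * x)) ∂μ

/-- The normalised and centred Laplace transform of a point configuration. -/
def centredLaplace (z : ℂ) (μ : Measure ℝ) : ℂ :=
  (∫ x : ℝ, Complex.exp (-z * x) ∂μ) / B.m z - 1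

theorem measurable_realLaplace (t : ℝ) : Measurable (realLaplace t) :=
  Measure.measurable_lintegral (by fun_prop)

theorem measurable_centredLaplace (z : ℂ) : Measurable (B.centredLaplace z) :=
  ((measurable_integral_measure (by fun_prop)).div_const _).sub_const _

theorem measurable_offspring (u : List ℕ) : Measurable (B.offspring u) := by
  refine (B.measurable_J u).prodMk (measurable_pi_lambda _ fun i => ?_)
  exact Measurable.ite (measurableSet_natCast_lt (B.measurable_J u) i) (B.measurable_X u i)
    measurable_const

theorem litter_eq (u : List ℕ) (ω : Ω) :
    B.litter u ω = pointConfiguration (B.offspring u ω).1 (B.offspring u ω).2 := by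
  classical
  simp only [litter, pointConfiguration, offspring]
  congr 1
  ext1 i
  split_ifs <;> rfl

theorem measurable_litter (u : List ℕ) : Measurable (B.litter u) := by
  have : B.litter u = (fun d : ℕ∞ × (ℕ → ℝ) => pointConfiguration d.1 d.2) ∘ B.offspring u :=
    funext fun ω => B.litter_eq u ω
  rw [this]
  exact measurable_pointConfiguration.comp (B.measurable_offspring u)

theorem iIndepFun_offspring : iIndepFun B.offspring P := by
  convert! B.indep

theorem iIndepFun_litter : iIndepFun B.litter P := by
  have := B.iIndepFun_offspring.comp (fun _ d => pointConfiguration d.1 d.2)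
    fun _ => measurable_pointConfiguration
  convert this using 1
  ext1 u; ext1 ω
  exact B.litter_eq u ω

theorem lintegral_realLaplace_litter (t : ℝ) (u : List ℕ) :
    ∫⁻ ω, realLaplace t (B.litter u ω) ∂P = B.mReal t := by
  have h := ((B.identDistrib u).comp (measurable_realLaplace t)).lintegral_eq
  refine h.trans ?_
  exact (Measure.lintegral_bind (B.measurable_litter []).aemeasurable (by fun_prop)).symm

theorem enorm_weight (n : ℕ) (z : ℂ) (u : List ℕ) (ω : Ω) :
    ‖B.weight n z u ω‖ₑ = B.realWeight n z.re u ω := by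
  classical
  rw [weight, realWeight]
  split_ifs
  · rw [← ofReal_norm, Complex.norm_exp]
    simp
  · simp

theorem realWeight_rpow (n : ℕ) (t : ℝ) (u : List ℕ) (ω : Ω) {r : ℝ} (hr : 0 < r) :
    B.realWeight n t u ω ^ r = B.realWeight n (r * t) u ω := by
  classical
  rw [realWeight, realWeight]
  split_ifs
  · rw [ENNReal.ofReal_rpow_of_nonneg (Real.exp_pos _).le hr.le, ← Real.exp_mul]
    congr 2; ring
  · simp [hr]

theorem integral_generation (n : ℕ) (z : ℂ) (ω : Ω) :
    ∫ x : ℝ, Complex.exp (-z * x) ∂(B.generation n ω) = ∑' u, B.weight n z u ω := by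
  classical
  rw [generation]
  refine (integral_sum_ite_dirac _ _ _).trans (tsum_congr fun u => ?_)
  rw [weight]

theorem lintegral_generation (n : ℕ) (t : ℝ) (ω : Ω) :
    ∫⁻ x, ENNReal.ofReal (Real.exp (-t * x)) ∂(B.generation n ω) = B.realSum n t ω := by
  classical
  rw [generation]
  refine (lintegral_sum_ite_dirac _ _ _).trans (tsum_congr fun u => ?_)
  rw [realWeight]

open Classical in
theorem integral_litter (z : ℂ) (u : List ℕ) (ω : Ω) :
    ∫ x : ℝ, Complex.exp (-z * x) ∂(B.litter u ω) =
      ∑' i : ℕ, if (i : ℕ∞) < B.J u ω then Complex.exp (-z * B.X u i ω) else 0 := by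
  rw [litter, pointConfiguration]
  exact integral_sum_ite_dirac _ _ _

open Classical in
theorem realLaplace_litter (t : ℝ) (u : List ℕ) (ω : Ω) :
    realLaplace t (B.litter u ω) = ∑' i : ℕ, if (i : ℕ∞) < B.J u ω
      then ENNReal.ofReal (Real.exp (-t * B.X u i ω)) else 0 := by
  rw [realLaplace, litter, pointConfiguration]
  exact lintegral_sum_ite_dirac _ _ _

open Classical in
theorem weight_succ_cons (n : ℕ) (z : ℂ) (i : ℕ) (u : List ℕ) (ω : Ω) :
    B.weight (n + 1) z (i :: u) ω = B.weight n z u ω *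
      if (i : ℕ∞) < B.J u ω then Complex.exp (-z * B.X u i ω) else 0 := by
  simp only [weight, Born, S, List.length_cons, Nat.add_right_cancel_iff]
  by_cases h1 : u.length = n ∧ B.Born u ω <;> by_cases h2 : (i : ℕ∞) < B.J u ω
  · rw [if_pos ⟨h1.1, h1.2, h2⟩, if_pos h1, if_pos h2, ← Complex.exp_add]
    congr 1; push_cast; ring
  · rw [if_neg (fun h => h2 h.2.2), if_neg h2, mul_zero]
  · rw [if_neg (fun h => h1 ⟨h.1, h.2.1⟩), if_neg h1, zero_mul]
  · rw [if_neg (fun h => h2 h.2.2), if_neg h2, mul_zero]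

open Classical in
theorem realWeight_succ_cons (n : ℕ) (t : ℝ) (i : ℕ) (u : List ℕ) (ω : Ω) :
    B.realWeight (n + 1) t (i :: u) ω = B.realWeight n t u ω *
      if (i : ℕ∞) < B.J u ω then ENNReal.ofReal (Real.exp (-t * B.X u i ω)) else 0 := by
  have h := congrArg (fun c : ℂ => ‖c‖ₑ) (B.weight_succ_cons n t i u ω)
  simp only [enorm_mul, enorm_weight, Complex.ofReal_re] at h
  rw [h]
  congr 1
  split_ifs
  · rw [← ofReal_norm, Complex.norm_exp]
    simp
  · simp

theorem weight_of_length_ne {n : ℕ} (z : ℂ) {u : List ℕ} (hu : u.length ≠ n) (ω : Ω) :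
    B.weight n z u ω = 0 := by
  classical
  rw [weight, if_neg fun h => hu h.1]

theorem weight_zero_nil (z : ℂ) (ω : Ω) : B.weight 0 z [] ω = 1 := by
  classical
  simp [weight, Born, S]

theorem support_weight_succ_subset (n : ℕ) (z : ℂ) (ω : Ω) :
    (Function.support fun u => B.weight (n + 1) z u ω) ⊆
      Set.range fun q : List ℕ × ℕ => q.2 :: q.1 := by
  intro u hu
  cases u with
  | nil => exact absurd (B.weight_of_length_ne z (by simp) ω) hu
  | cons i u => exact ⟨(u, i), rfl⟩

/-- Reindexes sums over generation `n + 1` by pairs (parent, child number). -/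
theorem cons_injective : Function.Injective fun q : List ℕ × ℕ => q.2 :: q.1 := by
  rintro ⟨u, i⟩ ⟨v, j⟩ h
  simp only [List.cons.injEq] at h
  rw [h.1, h.2]

theorem realSum_succ (n : ℕ) (t : ℝ) (ω : Ω) :
    B.realSum (n + 1) t ω = ∑' u, B.realWeight n t u ω * realLaplace t (B.litter u ω) := by
  classical
  rw [realSum, ← cons_injective.tsum_eq, ENNReal.tsum_prod']
  · refine tsum_congr fun u => ?_
    simp only [realWeight_succ_cons, ENNReal.tsum_mul_left, realLaplace_litter]
  · refine subset_trans (fun u hu => ?_) (B.support_weight_succ_subset n t ω)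
    have h := B.enorm_weight (n + 1) t u ω
    rw [Complex.ofReal_re] at h
    intro h0
    simp only [h0, enorm_zero] at h
    exact hu h.symm

theorem summable_weight {n : ℕ} {z : ℂ} {ω : Ω} (h : B.realSum n z.re ω ≠ ∞) :
    Summable fun u => B.weight n z u ω := by
  refine Summable.of_norm ?_
  have h' : ∑' u, ‖B.weight n z u ω‖ₑ ≠ ∞ := by simpa only [enorm_weight, realSum] using h
  simpa using ENNReal.summable_toReal h'

/-- Absolute convergence over generation `n + 1` permits grouping its individuals by parent. -/
theorem hasSum_weight_succ {n : ℕ} {z : ℂ} {ω : Ω} (h : B.realSum (n + 1) z.re ω ≠ ∞) :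
    HasSum (fun u => B.weight n z u ω * ∫ x : ℝ, Complex.exp (-z * x) ∂(B.litter u ω))
      (∑' u, B.weight (n + 1) z u ω) := by
  classical
  have hs := (B.summable_weight h).comp_injective cons_injective
  have h1 := hs.tsum_prod
  have h2 := hs.prod
  simp only [Function.comp_apply, weight_succ_cons, tsum_mul_left, ← integral_litter] at h1 h2
  rw [← cons_injective.tsum_eq (B.support_weight_succ_subset n z ω)]
  simp only [weight_succ_cons]
  rw [h1]
  exact h2.hasSum

theorem realSum_zero (t : ℝ) (ω : Ω) : B.realSum 0 t ω = 1 := by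
  rw [realSum, tsum_eq_single []]
  · simpa using (B.enorm_weight 0 t [] ω).symm.trans (by rw [weight_zero_nil]; simp)
  · intro u hu
    have := B.enorm_weight 0 t u ω
    rw [B.weight_of_length_ne _ (by simpa using hu)] at this
    simpa using this.symm

theorem realSum_one (t : ℝ) (ω : Ω) : B.realSum 1 t ω = realLaplace t (B.litter [] ω) := by
  rw [realSum_succ, tsum_eq_single []]
  · have := B.enorm_weight 0 t [] ω
    rw [weight_zero_nil, Complex.ofReal_re, enorm_one] at this
    rw [← this, one_mul]
  · intro u hu
    have := B.enorm_weight 0 t u ω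
    rw [B.weight_of_length_ne _ (by simpa using hu), Complex.ofReal_re, enorm_zero] at this
    rw [← this, zero_mul]

theorem Z_zero (z : ℂ) (ω : Ω) : B.Z 0 z ω = 1 := by
  rw [Z, integral_generation, pow_zero, div_one, tsum_eq_single []]
  · exact B.weight_zero_nil z ω
  · intro u hu
    exact B.weight_of_length_ne _ (by simpa using hu) _

/-! ### Independence of a generation and its litters -/

/-- The information about the reproduction of the first `n` generations. -/
@[reducible]
def past (n : ℕ) : MeasurableSpace Ω :=
  ⨆ u ∈ {u : List ℕ | u.length < n}, MeasurableSpace.comap (B.offspring u) inferInstance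

/-- Induction along the ancestral line: the weight of `i :: u` is that of `u` times a function of
the offspring of `u`. -/
theorem measurable_weight_past (z : ℂ) (n : ℕ) (u : List ℕ) :
    Measurable[B.past n] (B.weight n z u) := by
  classical
  by_cases hu : u.length = n
  swap
  · have : B.weight n z u = fun _ => 0 := funext fun ω => B.weight_of_length_ne z hu ω
    rw [this]
    exact measurable_const
  induction u generalizing n with
  | nil =>
    simp only [List.length_nil] at hu
    subst hu
    have : B.weight 0 z [] = fun _ => 1 := funext fun ω => B.weight_zero_nil z ω
    rw [this]
    exact measurable_const
  | cons i u ih =>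
    simp only [List.length_cons] at hu
    subst hu
    have hmono : B.past u.length ≤ B.past (u.length + 1) :=
      biSup_mono fun v hv => Nat.lt_succ_of_lt hv
    have hoff : Measurable[B.past (u.length + 1)] (B.offspring u) := by
      refine Measurable.mono (comap_measurable (B.offspring u)) ?_ le_rfl
      exact le_biSup (fun u => MeasurableSpace.comap (B.offspring u) inferInstance)
        (show u ∈ {v : List ℕ | v.length < u.length + 1} by simp)
    have e : B.weight (u.length + 1) z (i :: u) = fun ω => B.weight u.length z u ω *
        (fun d : ℕ∞ × (ℕ → ℝ) => if (i : ℕ∞) < d.1 then Complex.exp (-z * (d.2 i : ℝ)) else 0)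
          (B.offspring u ω) := by
      ext1 ω
      rw [weight_succ_cons]
      simp only [offspring]
      split_ifs <;> rfl
    rw [e]
    have hg : Measurable (fun d : ℕ∞ × (ℕ → ℝ) =>
        if (i : ℕ∞) < d.1 then Complex.exp (-z * (d.2 i : ℝ)) else 0) :=
      Measurable.ite (measurableSet_natCast_lt measurable_fst i)
        (by fun_prop) measurable_const
    exact Measurable.mul (Measurable.mono (ih _ rfl) hmono le_rfl) (hg.comp hoff)

theorem past_le (n : ℕ) : B.past n ≤ ‹MeasurableSpace Ω› :=
  iSup₂_le fun u _ => (B.measurable_offspring u).comap_le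

theorem measurable_weight (z : ℂ) (n : ℕ) (u : List ℕ) : Measurable (B.weight n z u) :=
  Measurable.mono (B.measurable_weight_past z n u) (B.past_le n) le_rfl

theorem measurable_realWeight (t : ℝ) (n : ℕ) (u : List ℕ) : Measurable (B.realWeight n t u) := by
  have := (B.measurable_weight t n u).enorm
  simpa only [enorm_weight, Complex.ofReal_re] using this

theorem measurable_realSum (t : ℝ) (n : ℕ) : Measurable (B.realSum n t) :=
  Measurable.tsum fun u => B.measurable_realWeight t n u

theorem measurable_Z (z : ℂ) (n : ℕ) : Measurable (B.Z n z) := by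
  have : B.Z n z = fun ω => (∑' u, B.weight n z u ω) / B.m z ^ n :=
    funext fun ω => by rw [Z, integral_generation]
  rw [this]
  exact (Measurable.tsum fun u => B.measurable_weight z n u).div_const _

/-- The litters of the individuals of generation `n`. -/
def litters (n : ℕ) (ω : Ω) (u : List ℕ) : Measure ℝ :=
  if u.length = n then B.litter u ω else 0

theorem measurable_litters (n : ℕ) : Measurable (B.litters n) := by
  refine measurable_pi_lambda _ fun u => ?_
  by_cases hu : u.length = n
  · simpa only [litters, hu, if_true] using B.measurable_litter u
  · simp only [litters, hu, if_false]; exact measurable_const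

/-- The weights depend on offspring of words of length less than `n`, the litters on words of length
exactly `n`: disjoint blocks of an independent family. -/
theorem indepFun_weight_litters (z : ℂ) (n : ℕ) :
    IndepFun (fun ω u => B.weight n z u ω) (B.litters n) P := by
  have hI : iIndep (fun u => MeasurableSpace.comap (B.offspring u) inferInstance) P :=
    B.iIndepFun_offspring
  have h := indep_iSup_of_disjoint (fun u => (B.measurable_offspring u).comap_le) hI
    (S := {u : List ℕ | u.length < n}) (T := {u : List ℕ | u.length = n})
    (Set.disjoint_left.2 fun u h1 h2 => by
      exact absurd h2 (Nat.ne_of_lt h1))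
  have h1 : Measurable[⨆ u ∈ {u : List ℕ | u.length = n},
      MeasurableSpace.comap (B.offspring u) inferInstance] (B.litters n) := by
    refine @measurable_pi_lambda _ _ _ (_) _ _ fun u => ?_
    by_cases hu : u.length = n
    · simp only [litters, hu, if_true, litter_eq]
      refine measurable_pointConfiguration.comp
        (Measurable.mono (comap_measurable (B.offspring u)) ?_ le_rfl)
      exact le_biSup (fun u => MeasurableSpace.comap (B.offspring u) inferInstance)
        (show u ∈ {v : List ℕ | v.length = n} from hu)
    · simp only [litters, hu, if_false]; exact measurable_const
  have h2 : Measurable[B.past n] fun ω u => B.weight n z u ω :=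
    @measurable_pi_lambda _ _ _ (_) _ _ fun u => B.measurable_weight_past z n u
  exact indep_of_indep_of_le_left (indep_of_indep_of_le_right h h1.comap_le) h2.comap_le

theorem lintegral_weight_litters [IsProbabilityMeasure P] (z : ℂ) (n : ℕ)
    {G : (List ℕ → ℂ) × (List ℕ → Measure ℝ) → ℝ≥0∞} (hG : Measurable G) :
    ∫⁻ ω, G (fun u => B.weight n z u ω, B.litters n ω) ∂P =
      ∫⁻ ω, ∫⁻ ω', G (fun u => B.weight n z u ω, B.litters n ω') ∂P ∂P :=
  lintegral_comp_prodMk_of_indepFun (measurable_pi_lambda _ fun u => B.measurable_weight z n u)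
    (B.measurable_litters n) (B.indepFun_weight_litters z n) hG

theorem lintegral_realSum_succ_rpow [IsProbabilityMeasure P] (t q : ℝ) (n : ℕ) :
    ∫⁻ ω, B.realSum (n + 1) t ω ^ q ∂P = ∫⁻ ω, ∫⁻ ω',
      (∑' u, B.realWeight n t u ω * realLaplace t (B.litter u ω')) ^ q ∂P ∂P := by
  -- The independence statement concerns complex weights; the real ones are their norms at the real
  -- argument `t`.
  have hG : Measurable fun a : (List ℕ → ℂ) × (List ℕ → Measure ℝ) =>
      (∑' u, ‖a.1 u‖ₑ * realLaplace t (a.2 u)) ^ q := by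
    refine (Measurable.tsum fun u => ?_).pow_const _
    exact ((measurable_pi_apply u).comp measurable_fst).enorm.mul
      ((measurable_realLaplace t).comp ((measurable_pi_apply u).comp measurable_snd))
  have e : ∀ ω ω' u, ‖B.weight n t u ω‖ₑ * realLaplace t (B.litters n ω' u) =
      B.realWeight n t u ω * realLaplace t (B.litter u ω') := by
    intro ω ω' u
    by_cases hu : u.length = n
    · rw [litters, if_pos hu, enorm_weight, Complex.ofReal_re]
    · have := B.enorm_weight n t u ω
      rw [Complex.ofReal_re] at this
      rw [← this, B.weight_of_length_ne _ hu]; simp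
  have h := B.lintegral_weight_litters t n hG
  simp only [e] at h
  rw [← h]
  simp only [realSum_succ]

theorem lintegral_realSum [IsProbabilityMeasure P] (t : ℝ) (n : ℕ) :
    ∫⁻ ω, B.realSum n t ω ∂P = B.mReal t ^ n := by
  induction n with
  | zero => simp [realSum_zero]
  | succ n ih =>
    have h := B.lintegral_realSum_succ_rpow t 1 n
    simp only [ENNReal.rpow_one] at h
    rw [h, pow_succ, ← ih, ← lintegral_mul_const _ (B.measurable_realSum t n)]
    refine lintegral_congr fun ω => ?_
    have hm : ∀ u, Measurable fun ω' => realLaplace t (B.litter u ω') := fun u =>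
      (measurable_realLaplace t).comp (B.measurable_litter u)
    rw [lintegral_tsum fun u => ((hm u).const_mul _).aemeasurable, realSum,
      ← ENNReal.tsum_mul_right]
    refine tsum_congr fun u => ?_
    rw [lintegral_const_mul _ (hm u), lintegral_realLaplace_litter]

theorem ae_realSum_ne_top [IsProbabilityMeasure P] {t : ℝ} (ht : B.mReal t < ∞) (n : ℕ) :
    ∀ᵐ ω ∂P, B.realSum n t ω ≠ ∞ := by
  have h : ∫⁻ ω, B.realSum n t ω ∂P ≠ ∞ := by
    rw [lintegral_realSum]; exact ENNReal.pow_ne_top ht.ne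
  filter_upwards [ae_lt_top (B.measurable_realSum t n) h] with ω hω using hω.ne

/-- The martingale increments are weighted sums over a generation of centred variables. -/
theorem ae_Z_succ_sub_Z [IsProbabilityMeasure P] {z : ℂ} (hfin : B.mReal z.re < ∞)
    (hm : B.m z ≠ 0) (n : ℕ) :
    ∀ᵐ ω ∂P, B.Z (n + 1) z ω - B.Z n z ω =
      (∑' u, B.weight n z u ω * B.centredLaplace z (B.litter u ω)) / B.m z ^ n := by
  filter_upwards [B.ae_realSum_ne_top hfin n, B.ae_realSum_ne_top hfin (n + 1)] with ω h1 h2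
  have h := ((B.hasSum_weight_succ h2).div_const (B.m z)).sub (B.summable_weight h1).hasSum
  have e : ∀ u, B.weight n z u ω * B.centredLaplace z (B.litter u ω) =
      B.weight n z u ω * (∫ x : ℝ, Complex.exp (-z * x) ∂(B.litter u ω)) / B.m z
        - B.weight n z u ω := fun u => by rw [centredLaplace]; ring
  simp only [e]
  rw [h.tsum_eq, Z, Z, integral_generation, integral_generation]
  field_simp
  ring

/-! ### Independence and centring of the litter transforms -/

/-- The litter of the ancestor as an s-finite kernel. -/
def litterKernel : Kernel Ω ℝ := ⟨B.litter [], B.measurable_litter []⟩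

/-- A litter may have infinitely many points, so the kernel is split into its single atoms;
s-finiteness allows the exchange of integrals that identifies `m z` with a mean over litters. -/
instance : IsSFiniteKernel B.litterKernel := by
  classical
  have e : B.litterKernel = Kernel.sum fun i : ℕ =>
      Kernel.piecewise (measurableSet_natCast_lt (B.measurable_J []) i)
        (Kernel.deterministic (B.X [] i) (B.measurable_X [] i)) 0 := by
    ext1 ω
    rw [Kernel.sum_apply]
    refine congrArg Measure.sum (funext fun i => ?_)
    rw [Kernel.piecewise_apply, Kernel.deterministic_apply]
    by_cases h : (i : ℕ∞) < B.J [] ω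
    · rw [if_pos h, if_pos (show ω ∈ {ω | (i : ℕ∞) < B.J [] ω} from h)]
    · rw [if_neg h, if_neg (show ω ∉ {ω | (i : ℕ∞) < B.J [] ω} from h)]; rfl
  rw [e]
  infer_instance

theorem integrable_exp_intensity {z : ℂ} (hfin : B.mReal z.re < ∞) :
    Integrable (fun x : ℝ => Complex.exp (-z * x)) B.intensity := by
  refine ⟨by fun_prop, ?_⟩
  rw [hasFiniteIntegral_iff_enorm]
  refine lt_of_eq_of_lt (lintegral_congr fun x => ?_) hfin
  rw [← ofReal_norm, Complex.norm_exp]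
  simp

theorem integral_centredLaplace_litter [IsProbabilityMeasure P] {z : ℂ}
    (hfin : B.mReal z.re < ∞) (hm : B.m z ≠ 0) (u : List ℕ) :
    ∫ ω, B.centredLaplace z (B.litter u ω) ∂P = 0 := by
  have h := ((B.identDistrib u).comp (B.measurable_centredLaplace z)).integral_eq
  refine h.trans ?_
  have hint : Integrable (fun x : ℝ => Complex.exp (-z * x))
      ((B.litterKernel ∘ₖ Kernel.const Unit P) ()) := by
    rw [Kernel.comp_apply, Kernel.const_apply]
    exact B.integrable_exp_intensity hfin
  have h1 := Kernel.integral_comp hint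
  have h2 := hint.integral_comp
  rw [Kernel.comp_apply, Kernel.const_apply] at h1
  rw [Kernel.const_apply] at h2
  have h3 : B.m z = ∫ ω, ∫ x : ℝ, Complex.exp (-z * x) ∂(B.litter [] ω) ∂P := h1
  have h4 : Integrable (fun ω => ∫ x : ℝ, Complex.exp (-z * x) ∂(B.litter [] ω)) P := h2
  change ∫ ω, ((∫ x : ℝ, Complex.exp (-z * x) ∂(B.litter [] ω)) / B.m z - 1) ∂P = 0
  rw [integral_sub (h4.div_const _) (integrable_const _), integral_div, ← h3, div_self hm]
  simp

theorem iIndepFun_centredLaplace (z : ℂ) :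
    iIndepFun (fun u ω => B.centredLaplace z (B.litter u ω)) P :=
  B.iIndepFun_litter.comp (fun _ => B.centredLaplace z) fun _ => B.measurable_centredLaplace z

theorem iIndepFun_realLaplace (t : ℝ) :
    iIndepFun (fun u ω => realLaplace t (B.litter u ω)) P :=
  B.iIndepFun_litter.comp (fun _ => realLaplace t) fun _ => measurable_realLaplace t

theorem lintegral_litter_eq {g : Measure ℝ → ℝ≥0∞} (hg : Measurable g) (u : List ℕ) :
    ∫⁻ ω, g (B.litter u ω) ∂P = ∫⁻ ω, g (B.litter [] ω) ∂P :=
  ((B.identDistrib u).comp hg).lintegral_eq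

theorem ae_Z_one [IsProbabilityMeasure P] {z : ℂ} (hfin : B.mReal z.re < ∞) (hm : B.m z ≠ 0) :
    ∀ᵐ ω ∂P, B.Z 1 z ω = 1 + B.centredLaplace z (B.litter [] ω) := by
  filter_upwards [B.ae_Z_succ_sub_Z hfin hm 0] with ω h
  rw [Z_zero, pow_zero, div_one, tsum_eq_single [] fun u hu => by
    rw [B.weight_of_length_ne _ (by simpa using hu), zero_mul], weight_zero_nil, one_mul] at h
  rw [← h]; ring

/-! ### Moments of the martingale increments and of the real sums -/

/-- The `p`-th moment of a martingale increment. -/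
theorem lintegral_Z_succ_sub_Z [IsProbabilityMeasure P] {z : ℂ} (hfin : B.mReal z.re < ∞)
    (hm : B.m z ≠ 0) {p : ℝ} (hp : 0 ≤ p) (n : ℕ) :
    ∫⁻ ω, ‖B.Z (n + 1) z ω - B.Z n z ω‖ₑ ^ p ∂P =
      (∫⁻ ω, ∫⁻ ω', ‖∑' u, B.weight n z u ω * B.centredLaplace z (B.litter u ω')‖ₑ ^ p ∂P ∂P)
        / (‖B.m z‖ₑ ^ p) ^ n := by
  have hG : Measurable fun a : (List ℕ → ℂ) × (List ℕ → Measure ℝ) =>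
      ‖∑' u, a.1 u * B.centredLaplace z (a.2 u)‖ₑ ^ p := by
    refine (Measurable.tsum fun u => ?_).enorm.pow_const _
    exact ((measurable_pi_apply u).comp measurable_fst).mul
      ((B.measurable_centredLaplace z).comp ((measurable_pi_apply u).comp measurable_snd))
  have e : ∀ ω ω' u, B.weight n z u ω * B.centredLaplace z (B.litters n ω' u) =
      B.weight n z u ω * B.centredLaplace z (B.litter u ω') := by
    intro ω ω' u
    by_cases hu : u.length = n
    · rw [litters, if_pos hu]
    · rw [B.weight_of_length_ne _ hu, zero_mul, zero_mul]
  have h := B.lintegral_weight_litters z n hG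
  simp only [e] at h
  rw [← h, div_eq_mul_inv, ← lintegral_mul_const']
  · refine lintegral_congr_ae ?_
    filter_upwards [B.ae_Z_succ_sub_Z hfin hm n] with ω hω
    rw [hω, div_eq_mul_inv, enorm_mul, ENNReal.mul_rpow_of_nonneg _ _ hp, enorm_inv (by simp [hm]),
      enorm_pow, ENNReal.inv_rpow, ← ENNReal.rpow_natCast, ← ENNReal.rpow_natCast,
      ← ENNReal.rpow_mul, ← ENNReal.rpow_mul, mul_comm p]
  · rw [ENNReal.inv_ne_top]
    exact pow_ne_zero _ (by simp [hm])

theorem tsum_enorm_weight_sq (n : ℕ) (z : ℂ) (ω : Ω) :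
    ∑' u, ‖B.weight n z u ω‖ₑ ^ 2 = B.realSum n (2 * z.re) ω := by
  refine tsum_congr fun u => ?_
  rw [enorm_weight, ← ENNReal.rpow_two, realWeight_rpow _ _ _ _ _ (by norm_num)]

theorem lintegral_enorm_centredLaplace [IsProbabilityMeasure P] {z : ℂ}
    (hfin : B.mReal z.re < ∞) (hm : B.m z ≠ 0) (p : ℝ) (u : List ℕ) :
    ∫⁻ ω, ‖B.centredLaplace z (B.litter u ω)‖ₑ ^ p ∂P = ∫⁻ ω, ‖B.Z 1 z ω - 1‖ₑ ^ p ∂P := by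
  rw [B.lintegral_litter_eq (g := fun μ => ‖B.centredLaplace z μ‖ₑ ^ p)
    ((B.measurable_centredLaplace z).enorm.pow_const _)]
  refine lintegral_congr_ae ?_
  filter_upwards [B.ae_Z_one hfin hm] with ω hω
  rw [hω, add_sub_cancel_left]

/-- An upper bound for the increments in terms of the real sums at `2 re z`. -/
theorem exists_lintegral_Z_succ_sub_Z_le [IsProbabilityMeasure P] {z : ℂ}
    (hfin : B.mReal z.re < ∞) (hm : B.m z ≠ 0) {p : ℝ} (hp : 2 ≤ p)
    (hmom : ∫⁻ ω, ‖B.Z 1 z ω - 1‖ₑ ^ p ∂P ≠ ∞) :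
    ∃ L : ℝ≥0∞, L ≠ ∞ ∧ ∀ n, ∫⁻ ω, ‖B.Z (n + 1) z ω - B.Z n z ω‖ₑ ^ p ∂P ≤
      L * (∫⁻ ω, B.realSum n (2 * z.re) ω ^ (p / 2) ∂P) / (‖B.m z‖ₑ ^ p) ^ n := by
  obtain ⟨L, hL, h⟩ := exists_lintegral_enorm_tsum_rpow_le hp
    (fun u => (B.measurable_centredLaplace z).comp (B.measurable_litter u))
    (B.iIndepFun_centredLaplace z) (B.integral_centredLaplace_litter hfin hm) hmom
    (fun u => (B.lintegral_enorm_centredLaplace hfin hm p u).le)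
  refine ⟨L, hL, fun n => ?_⟩
  rw [B.lintegral_Z_succ_sub_Z hfin hm (by linarith) n]
  gcongr
  rw [← lintegral_const_mul _ ((B.measurable_realSum _ n).pow_const _)]
  refine lintegral_mono fun ω => (h _).trans ?_
  rw [tsum_enorm_weight_sq]

/-- Lower counterpart with the variance of `Z_1` as constant. Given generation `n`, the weights are
almost surely absolutely summable because `m(re z)` is finite. -/
theorem le_lintegral_Z_succ_sub_Z [IsProbabilityMeasure P] {z : ℂ}
    (hfin : B.mReal z.re < ∞) (hm : B.m z ≠ 0) {p : ℝ} (hp : 2 ≤ p)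
    (hmom : ∫⁻ ω, ‖B.Z 1 z ω - 1‖ₑ ^ (2 : ℝ) ∂P ≠ ∞) (n : ℕ) :
    (∫⁻ ω, ‖B.Z 1 z ω - 1‖ₑ ^ (2 : ℝ) ∂P) ^ (p / 2) *
      (∫⁻ ω, B.realSum n (2 * z.re) ω ^ (p / 2) ∂P) / (‖B.m z‖ₑ ^ p) ^ n ≤
      ∫⁻ ω, ‖B.Z (n + 1) z ω - B.Z n z ω‖ₑ ^ p ∂P := by
  rw [B.lintegral_Z_succ_sub_Z hfin hm (by linarith) n]
  gcongr
  rw [← lintegral_const_mul _ ((B.measurable_realSum _ n).pow_const _)]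
  refine lintegral_mono_ae ?_
  filter_upwards [B.ae_realSum_ne_top hfin n] with ω hω
  rw [← ENNReal.mul_rpow_of_nonneg _ _ (by linarith), ← tsum_enorm_weight_sq]
  refine le_lintegral_enorm_tsum_rpow hp
    (fun u => (B.measurable_centredLaplace z).comp (B.measurable_litter u))
    (B.iIndepFun_centredLaplace z) (B.integral_centredLaplace_litter hfin hm) hmom
    (fun u => ?_) ?_
  · rw [← B.lintegral_enorm_centredLaplace hfin hm 2 u]
    simp
  · simpa only [enorm_weight, realSum] using hω

/-- Geometric growth of the moments of the real sums. -/
theorem exists_lintegral_realSum_rpow_le [IsProbabilityMeasure P] {t q : ℝ} (hq : 1 ≤ q)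
    {Q : ℝ≥0∞} (ht0 : B.mReal t ≠ 0) (ht : B.mReal t < Q)
    (htq : B.mReal (q * t) < Q ^ q) (hmom : ∫⁻ ω, B.realSum 1 t ω ^ q ∂P ≠ ∞) :
    ∃ K R : ℝ≥0∞, K ≠ ∞ ∧ R < Q ^ q ∧ ∀ n, ∫⁻ ω, B.realSum n t ω ^ q ∂P ≤ K * R ^ n := by
  have hq0 : 0 < q := by linarith
  obtain ⟨A, hA1, hA2⟩ := ENNReal.lt_iff_exists_nnreal_btwn.1 ht
  obtain ⟨C, hC, h⟩ := exists_lintegral_tsum_rpow_le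
    (fun u => (measurable_realLaplace t).comp (B.measurable_litter u))
    (B.iIndepFun_realLaplace t) ht0 (fun u => (B.lintegral_realLaplace_litter t u).le) hq0 hA1
    (by simp) hmom (fun u => by
      refine le_of_eq ((B.lintegral_litter_eq (g := fun μ => realLaplace t μ ^ q)
        ((measurable_realLaplace t).pow_const _) u).trans ?_)
      simp only [realSum_one])
  -- Conditionally on generation `n`, the sum of `q`-th powers of the weights is the real sum at `q
  -- * t`, with mean `mReal (q * t) ^ n`.
  have hrec : ∀ n, ∫⁻ ω, B.realSum (n + 1) t ω ^ q ∂P ≤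
      (A : ℝ≥0∞) ^ q * ∫⁻ ω, B.realSum n t ω ^ q ∂P + C * B.mReal (q * t) ^ n := by
    intro n
    rw [B.lintegral_realSum_succ_rpow, ← B.lintegral_realSum (q * t) n,
      ← lintegral_const_mul _ ((B.measurable_realSum _ n).pow_const _),
      ← lintegral_const_mul _ (B.measurable_realSum _ n),
      ← lintegral_add_left (((B.measurable_realSum _ n).pow_const _).const_mul _)]
    refine lintegral_mono fun ω => (h _).trans ?_
    simp only [realWeight_rpow _ _ _ _ _ hq0, realSum, le_refl]
  have hAQ : (A : ℝ≥0∞) ^ q < Q ^ q := ENNReal.rpow_lt_rpow hA2 hq0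
  -- `R` dominates both rates of the recursion strictly below `Q ^ q`; the constant `K` then
  -- satisfies `C ≤ K * (R - A ^ q)`, so that `K * R ^ n` is preserved by the recursion.
  obtain ⟨R, hR1, hR2⟩ := ENNReal.lt_iff_exists_nnreal_btwn.1 (max_lt hAQ htq)
  have hRA : (A : ℝ≥0∞) ^ q < R := (le_max_left _ _).trans_lt hR1
  have hRb : B.mReal (q * t) ≤ R := (le_max_right _ _).trans hR1.le
  have hd0 : (R : ℝ≥0∞) - (A : ℝ≥0∞) ^ q ≠ 0 := (tsub_pos_of_lt hRA).ne'
  have hdt : (R : ℝ≥0∞) - (A : ℝ≥0∞) ^ q ≠ ∞ := ENNReal.sub_ne_top (by simp)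
  refine ⟨1 + C / ((R : ℝ≥0∞) - (A : ℝ≥0∞) ^ q), R,
    ENNReal.add_ne_top.2 ⟨by simp, ENNReal.div_ne_top hC hd0⟩, hR2, fun n => ?_⟩
  set K : ℝ≥0∞ := 1 + C / ((R : ℝ≥0∞) - (A : ℝ≥0∞) ^ q) with hK
  have hKC : C ≤ K * ((R : ℝ≥0∞) - (A : ℝ≥0∞) ^ q) := by
    rw [hK, add_mul, ENNReal.div_mul_cancel hd0 hdt]
    exact le_add_self
  induction n with
  | zero => simp [realSum_zero, hK]
  | succ n ih =>
    calc _ ≤ (A : ℝ≥0∞) ^ q * (K * R ^ n) + K * ((R : ℝ≥0∞) - (A : ℝ≥0∞) ^ q) * R ^ n := by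
          refine (hrec n).trans ?_
          gcongr
      _ = K * R ^ n * ((A : ℝ≥0∞) ^ q + ((R : ℝ≥0∞) - (A : ℝ≥0∞) ^ q)) := by ring
      _ = K * R ^ (n + 1) := by rw [add_tsub_cancel_of_le hRA.le]; ring

end BranchingRandomWalk

/-! ### From increments to the convergence criterion -/

theorem ENNReal.lt_one_of_mul_pow_le_of_tendsto_zero {v x : ℝ≥0∞} (hv : v ≠ 0) {d : ℕ → ℝ≥0∞}
    (hd : Tendsto d atTop (𝓝 0)) (h : ∀ n, v * x ^ n ≤ d n) : x < 1 := by
  by_contra hx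
  refine hv (le_antisymm (ge_of_tendsto' hd fun n => ?_) zero_le)
  exact le_trans (le_mul_of_one_le_right' (one_le_pow₀ (not_lt.1 hx))) (h n)

theorem lintegral_enorm_rpow_eq_eLpNorm_rpow {Ω : Type*} [MeasurableSpace Ω] {P : Measure Ω}
    {p : ℝ} (hp : 0 < p) (Y : Ω → ℂ) :
    ∫⁻ ω, ‖Y ω‖ₑ ^ p ∂P = eLpNorm Y (ENNReal.ofReal p) P ^ p := by
  rw [eLpNorm_eq_lintegral_rpow_enorm_toReal (by simpa using hp) (by simp),
    ENNReal.toReal_ofReal hp.le, ← ENNReal.rpow_mul, one_div_mul_cancel hp.ne', ENNReal.rpow_one]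

namespace BranchingRandomWalk

variable {Ω : Type*} [MeasurableSpace Ω] {P : Measure Ω} (B : BranchingRandomWalk P)

theorem mReal_ne_zero {z : ℂ} (hm : B.m z ≠ 0) (t : ℝ) : B.mReal t ≠ 0 := by
  intro h
  rw [mReal, lintegral_eq_zero_iff (by fun_prop)] at h
  have h0 : B.intensity = 0 := by
    rw [← ae_eq_bot, ← Filter.eventually_false_iff_eq_bot]
    filter_upwards [h] with x hx
    simp only [Pi.zero_apply, ENNReal.ofReal_eq_zero] at hx
    exact absurd (Real.exp_pos _) (not_lt.2 hx)
  exact hm (by rw [m, h0, integral_zero_measure])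

theorem tendsto_lintegral_Z_succ_sub_Z {z : ℂ} {p : ℝ} (hp : 1 ≤ p)
    (h : ConvergesInLp P p (fun n => B.Z n z)) :
    Tendsto (fun n => ∫⁻ ω, ‖B.Z (n + 1) z ω - B.Z n z ω‖ₑ ^ p ∂P) atTop (𝓝 0) := by
  obtain ⟨hmem, Y, hY, hlim⟩ := h
  have hp0 : 0 < p := by linarith
  simp only [lintegral_enorm_rpow_eq_eLpNorm_rpow hp0]
  have h1 : Tendsto (fun n =>
      eLpNorm (fun ω => B.Z (n + 1) z ω - B.Z n z ω) (ENNReal.ofReal p) P) atTop (𝓝 0) := by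
    have h2 := ((tendsto_add_atTop_iff_nat 1).2 hlim).add hlim
    rw [add_zero] at h2
    refine tendsto_of_tendsto_of_tendsto_of_le_of_le tendsto_const_nhds h2
      (fun _ => zero_le) fun n => ?_
    have e : (fun ω => B.Z (n + 1) z ω - B.Z n z ω) =
        (fun ω => B.Z (n + 1) z ω - Y ω) - fun ω => B.Z n z ω - Y ω := by
      ext1 ω; simp
    rw [e]
    exact eLpNorm_sub_le ((hmem (n + 1)).sub hY).1 ((hmem n).sub hY).1
      (by simpa using hp)
  have h3 := (ENNReal.continuous_rpow_const (y := p)).tendsto 0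
  rw [ENNReal.zero_rpow_of_pos hp0] at h3
  exact h3.comp h1

/-- Geometrically small increments make the sequence Cauchy, and `L^p` is complete. -/
theorem convergesInLp_of_increments_le [IsProbabilityMeasure P] {z : ℂ} {p : ℝ} (hp : 1 ≤ p)
    {D r : ℝ≥0∞} (hD : D ≠ ∞) (hr : r < 1)
    (h : ∀ n, ∫⁻ ω, ‖B.Z (n + 1) z ω - B.Z n z ω‖ₑ ^ p ∂P ≤ D * r ^ n) :
    ConvergesInLp P p (fun n => B.Z n z) := by
  have hp0 : 0 < p := by linarith
  have hinc : ∀ n, eLpNorm (fun ω => B.Z (n + 1) z ω - B.Z n z ω) (ENNReal.ofReal p) P ≤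
      D ^ p⁻¹ * (r ^ p⁻¹) ^ n := by
    intro n
    have h1 := h n
    rw [lintegral_enorm_rpow_eq_eLpNorm_rpow hp0, ← ENNReal.le_rpow_inv_iff hp0,
      ENNReal.mul_rpow_of_nonneg _ _ (by positivity)] at h1
    refine h1.trans (le_of_eq ?_)
    rw [← ENNReal.rpow_natCast, ← ENNReal.rpow_natCast, ← ENNReal.rpow_mul, ← ENNReal.rpow_mul,
      mul_comm (n : ℝ)]
  have hD' : D ^ p⁻¹ ≠ ∞ := ENNReal.rpow_ne_top_of_nonneg (by positivity) hD
  have hr' : r ^ p⁻¹ < 1 := ENNReal.rpow_lt_one hr (by positivity)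
  have hmem : ∀ n, MemLp (B.Z n z) (ENNReal.ofReal p) P := by
    intro n
    induction n with
    | zero =>
      have : B.Z 0 z = fun _ => 1 := funext fun ω => B.Z_zero z ω
      rw [this]
      exact memLp_const 1
    | succ n ih =>
      have hs : MemLp (fun ω => B.Z (n + 1) z ω - B.Z n z ω) (ENNReal.ofReal p) P :=
        ⟨((B.measurable_Z z (n + 1)).sub (B.measurable_Z z n)).aestronglyMeasurable,
          (hinc n).trans_lt (ENNReal.mul_lt_top hD'.lt_top
            (ENNReal.pow_lt_top (hr'.trans ENNReal.one_lt_top)))⟩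
      convert ih.add hs using 1
      ext1 ω; simp
  have : Fact (1 ≤ ENNReal.ofReal p) := ⟨by simpa using hp⟩
  have hc : CauchySeq fun n => (hmem n).toLp (B.Z n z) := by
    refine cauchySeq_of_edist_le_geometric _ _ hr' hD' fun n => ?_
    rw [edist_comm, Lp.edist_toLp_toLp]
    exact hinc n
  obtain ⟨g, hg⟩ := cauchySeq_tendsto_of_complete hc
  refine ⟨hmem, g, Lp.memLp g, ?_⟩
  rw [Lp.tendsto_Lp_iff_tendsto_eLpNorm'] at hg
  refine hg.congr fun n => eLpNorm_congr_ae ?_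
  filter_upwards [(hmem n).coeFn_toLp] with ω hω
  simp [hω]

/-- The common form of both parts, with no case distinction on `θ` or `p`. Nondegeneracy makes the
variance of `Z_1` positive, so the lower bound on the increments is effective. -/
theorem convergesInLp_iff [IsProbabilityMeasure P] {z : ℂ} (hfin : B.mReal z.re < ∞)
    (hm : B.m z ≠ 0) (hnondeg : ¬ ∀ᵐ ω ∂P, B.Z 1 z ω = 1) {p : ℝ} (hp : 2 ≤ p) :
    ConvergesInLp P p (fun n => B.Z n z) ↔
      ∫⁻ ω, ‖B.Z 1 z ω‖ₑ ^ p ∂P < ∞ ∧ B.mReal (2 * z.re) < ‖B.m z‖ₑ ^ 2 ∧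
        B.mReal (p * z.re) < ‖B.m z‖ₑ ^ p ∧
        ∫⁻ ω, B.realSum 1 (2 * z.re) ω ^ (p / 2) ∂P < ∞ := by
  have hp0 : 0 < p := by linarith
  have hr : 1 ≤ p / 2 := by linarith
  have hmt : ‖B.m z‖ₑ ≠ ∞ := enorm_ne_top
  have hQ0 : ‖B.m z‖ₑ ^ p ≠ 0 := by
    simp [ENNReal.rpow_eq_zero_iff, hm, hp0.not_gt]
  have hQt : ‖B.m z‖ₑ ^ p ≠ ∞ := ENNReal.rpow_ne_top_of_nonneg hp0.le hmt
  have hQ2 : (‖B.m z‖ₑ ^ 2) ^ (p / 2) = ‖B.m z‖ₑ ^ p := by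
    rw [← ENNReal.rpow_two, ← ENNReal.rpow_mul, mul_div_cancel₀ _ (by norm_num)]
  have hpt : p / 2 * (2 * z.re) = p * z.re := by ring
  have hZ1 : ∫⁻ ω, ‖B.Z 1 z ω‖ₑ ^ p ∂P < ∞ → MemLp (fun ω => B.Z 1 z ω - 1) (ENNReal.ofReal p) P :=
    fun h => ((memLp_ofReal_iff hp0 (B.measurable_Z z 1).aestronglyMeasurable).2 h).sub
      (memLp_const 1)
  constructor
  · intro h
    have h1 : ∫⁻ ω, ‖B.Z 1 z ω‖ₑ ^ p ∂P < ∞ :=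
      (memLp_ofReal_iff hp0 (B.measurable_Z z 1).aestronglyMeasurable).1 (h.1 1)
    have hm2 : MemLp (fun ω => B.Z 1 z ω - 1) (ENNReal.ofReal 2) P :=
      (hZ1 h1).mono_exponent (ENNReal.ofReal_le_ofReal hp)
    set v := ∫⁻ ω, ‖B.Z 1 z ω - 1‖ₑ ^ (2 : ℝ) ∂P with hv
    have hvt : v ≠ ∞ := ((memLp_ofReal_iff (by norm_num) hm2.1).1 hm2).ne
    have hv0 : v ≠ 0 := by
      intro h0
      rw [hv, lintegral_eq_zero_iff
        (((B.measurable_Z z 1).sub_const 1).enorm.pow_const _)] at h0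
      refine hnondeg ?_
      filter_upwards [h0] with ω hω
      simpa [sub_eq_zero] using hω
    have hvp : v ^ (p / 2) ≠ 0 := by
      simp [ENNReal.rpow_eq_zero_iff, hv0, hvt]
    have hlow := B.le_lintegral_Z_succ_sub_Z hfin hm hp hvt
    have hlim := B.tendsto_lintegral_Z_succ_sub_Z (by linarith) h
    refine ⟨h1, ?_, ?_, ?_⟩
    · have hx : B.mReal (2 * z.re) ^ (p / 2) / ‖B.m z‖ₑ ^ p < 1 := by
        refine ENNReal.lt_one_of_mul_pow_le_of_tendsto_zero hvp hlim fun n => ?_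
        refine le_trans ?_ (hlow n)
        rw [mul_div_assoc]
        gcongr
        -- Jensen: `E W_n^{p/2} ≥ (E W_n)^{p/2}`.
        have hJ := rpow_lintegral_le_lintegral_rpow (P := P) hr (B.measurable_realSum (2 * z.re) n)
        rw [lintegral_realSum] at hJ
        rw [div_eq_mul_inv, mul_pow, ← ENNReal.inv_pow, ← div_eq_mul_inv]
        gcongr
        refine le_trans (le_of_eq ?_) hJ
        rw [← ENNReal.rpow_natCast, ← ENNReal.rpow_natCast, ← ENNReal.rpow_mul, ← ENNReal.rpow_mul,
          mul_comm (p / 2)]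
      rw [ENNReal.div_lt_iff (Or.inl hQ0) (Or.inl hQt), one_mul, ← hQ2] at hx
      exact (ENNReal.rpow_lt_rpow_iff (by linarith)).1 hx
    · have hx : B.mReal (p * z.re) / ‖B.m z‖ₑ ^ p < 1 := by
        refine ENNReal.lt_one_of_mul_pow_le_of_tendsto_zero hvp hlim fun n => ?_
        refine le_trans ?_ (hlow n)
        rw [mul_div_assoc]
        gcongr
        rw [div_eq_mul_inv, mul_pow, ← ENNReal.inv_pow, ← div_eq_mul_inv, ← lintegral_realSum]
        gcongr with ω
        -- Superadditivity of the power `p / 2 ≥ 1`: `W_n^{p/2}` dominates the real sum at `p *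
        -- z.re`.
        have hT := ENNReal.tsum_rpow_le_rpow_tsum hr fun u => B.realWeight n (2 * z.re) u ω
        simp only [B.realWeight_rpow _ _ _ _ (by linarith : 0 < p / 2), hpt] at hT
        exact hT
      rwa [ENNReal.div_lt_iff (Or.inl hQ0) (Or.inl hQt), one_mul] at hx
    -- The lower bound at `n = 1` transfers finiteness of the `p`-th moment of `Z_2 - Z_1` to the `p
    -- / 2`-th moment of `W_1`.
    · have hfin1 : ∫⁻ ω, ‖B.Z (1 + 1) z ω - B.Z 1 z ω‖ₑ ^ p ∂P < ∞ :=
        (memLp_ofReal_iff hp0 ((h.1 2).sub (h.1 1)).1).1 ((h.1 2).sub (h.1 1))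
      have hlt := (hlow 1).trans_lt hfin1
      rw [pow_one, ENNReal.div_lt_iff (Or.inl hQ0) (Or.inl hQt)] at hlt
      by_contra hc
      rw [not_lt, top_le_iff] at hc
      rw [hc, ENNReal.mul_top hvp] at hlt
      exact not_top_lt hlt
  · rintro ⟨h1, h2, h3, h4⟩
    have hd := (memLp_ofReal_iff hp0 (hZ1 h1).1).1 (hZ1 h1)
    obtain ⟨L, hL, hup⟩ := B.exists_lintegral_Z_succ_sub_Z_le hfin hm hp hd.ne
    obtain ⟨K, R, hK, hR, hgeo⟩ := B.exists_lintegral_realSum_rpow_le hr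
      (Q := ‖B.m z‖ₑ ^ 2) (B.mReal_ne_zero hm _) h2 (by rw [hpt, hQ2]; exact h3) h4.ne
    rw [hQ2] at hR
    refine B.convergesInLp_of_increments_le (by linarith) (D := L * K) (r := R / ‖B.m z‖ₑ ^ p)
      (ENNReal.mul_ne_top hL hK) ?_ fun n => (hup n).trans ?_
    · rwa [ENNReal.div_lt_iff (Or.inl hQ0) (Or.inl hQt), one_mul]
    · calc _ ≤ L * (K * R ^ n) / (‖B.m z‖ₑ ^ p) ^ n := by gcongr; exact hgeo n
        _ = _ := by
          rw [div_eq_mul_inv, div_eq_mul_inv, mul_pow, ENNReal.inv_pow]; ring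

theorem lintegral_ZReal_one_rpow_lt_top_iff {t q : ℝ} (hq : 0 ≤ q) (h0 : B.mReal t ≠ 0)
    (ht : B.mReal t ≠ ∞) :
    ∫⁻ ω, B.ZReal 1 t ω ^ q ∂P < ∞ ↔ ∫⁻ ω, B.realSum 1 t ω ^ q ∂P < ∞ := by
  have e : ∀ ω, B.ZReal 1 t ω ^ q = B.realSum 1 t ω ^ q * (B.mReal t ^ q)⁻¹ := fun ω => by
    rw [ZReal, lintegral_generation, pow_one, ENNReal.div_rpow_of_nonneg _ _ hq, div_eq_mul_inv]
  simp only [e]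
  have hc0 : B.mReal t ^ q ≠ 0 := by simp [ENNReal.rpow_eq_zero_iff, h0, ht]
  have hct : B.mReal t ^ q ≠ ∞ := ENNReal.rpow_ne_top_of_nonneg hq ht
  rw [lintegral_mul_const' _ _ (by simpa using hc0), ← div_eq_mul_inv,
    ENNReal.div_lt_iff (Or.inl hc0) (Or.inl hct), ENNReal.top_mul hc0]

end BranchingRandomWalk

end

theorem theorem3p4 {Ω : Type*} [MeasurableSpace Ω] (P : Measure Ω) [IsProbabilityMeasure P]
    (B : BranchingRandomWalk P) (hsuper : B.Supercritical)
    (p : ℝ) (hp : 2 ≤ p) (θ γ : ℝ) (hγ : γ ≠ 0)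
    (z : ℂ) (hz : z = (θ : ℂ) + (γ : ℂ) * Complex.I)
    (hfin : B.mReal θ < ∞) (hpos : 0 < ‖B.m z‖ₑ) (hlt : ‖B.m z‖ₑ < B.mReal θ)
    (hnondeg : ¬ ∀ᵐ ω ∂P, B.Z 1 z ω = 1) :
    (θ ≠ 0 →
      (ConvergesInLp P p (fun n => B.Z n z) ↔
        (∫⁻ ω, ‖B.Z 1 z ω‖ₑ ^ p ∂P < ∞ ∧
          max (B.mReal (2 * θ) / ‖B.m z‖ₑ ^ 2) (B.mReal (p * θ) / ‖B.m z‖ₑ ^ p) < 1 ∧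
          (2 < p → ∫⁻ ω, B.ZReal 1 (2 * θ) ω ^ (p / 2) ∂P < ∞)))) ∧
    (θ = 0 →
      (ConvergesInLp P p (fun n => B.Z n z) ↔
        (∫⁻ ω, ‖B.Z 1 z ω‖ₑ ^ p ∂P < ∞ ∧
          ∫⁻ ω, B.ZReal 1 0 ω ^ (p / 2) ∂P < ∞ ∧
          B.mReal 0 / ‖B.m z‖ₑ ^ 2 < 1))) := by
  have hre : z.re = θ := by simp [hz]
  have hm : B.m z ≠ 0 := by simpa [pos_iff_ne_zero] using hpos
  have hmt : ‖B.m z‖ₑ ≠ ∞ := enorm_ne_top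
  have hp0 : 0 < p := by linarith
  have hm0 : ‖B.m z‖ₑ ≠ 0 := hpos.ne'
  have hQ0 : ‖B.m z‖ₑ ^ p ≠ 0 := by simp [ENNReal.rpow_eq_zero_iff, hm, hp0.not_gt]
  have hQt : ‖B.m z‖ₑ ^ p ≠ ∞ := ENNReal.rpow_ne_top_of_nonneg hp0.le hmt
  have hS0 : ‖B.m z‖ₑ ^ 2 ≠ 0 := pow_ne_zero _ hm0
  have hSt : ‖B.m z‖ₑ ^ 2 ≠ ∞ := ENNReal.pow_ne_top hmt
  have hiff := B.convergesInLp_iff (by rwa [hre]) hm hnondeg hp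
  rw [hre] at hiff
  have hZR := fun t => B.lintegral_ZReal_one_rpow_lt_top_iff (t := t) (q := p / 2) (by linarith)
    (B.mReal_ne_zero hm t)
  refine ⟨fun _ => ?_, fun h0 => ?_⟩
  · rw [hiff, max_lt_iff, ENNReal.div_lt_iff (Or.inl hS0) (Or.inl hSt),
      ENNReal.div_lt_iff (Or.inl hQ0) (Or.inl hQt), one_mul, one_mul]
    constructor
    · rintro ⟨h1, h2, h3, h4⟩
      exact ⟨h1, ⟨h2, h3⟩, fun _ => (hZR _ (h2.trans_le le_top).ne).2 h4⟩
    · rintro ⟨h1, ⟨h2, h3⟩, h4⟩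
      refine ⟨h1, h2, h3, ?_⟩
      have h2t : B.mReal (2 * θ) < ∞ := h2.trans_le le_top
      rcases hp.eq_or_lt with rfl | hp2
      -- For `p = 2` the moment of `W_1` is its mean `m(2θ)`, already finite.
      · simpa [B.lintegral_realSum] using h2t
      · exact (hZR _ h2t.ne).1 (h4 hp2)
  · subst h0
    rw [mul_zero, mul_zero] at hiff
    rw [hiff, hZR 0 hfin.ne, ENNReal.div_lt_iff (Or.inl hS0) (Or.inl hSt), one_mul]
    constructor
    · rintro ⟨h1, h2, -, h4⟩
      exact ⟨h1, h4, h2⟩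
    · rintro ⟨h1, h4, h2⟩
      refine ⟨h1, h2, h2.trans_le ?_, h4⟩
      -- For `θ = 0` the condition at `p * θ` is `m(0) < |m(z)|^p`. It follows from `m(0) < |m(z)|²`
      -- once `|m(z)| ≥ 1`; otherwise `m(0) < |m(z)|² ≤ |m(z)| < m(0)`.
      have hone : 1 ≤ ‖B.m z‖ₑ := by
        by_contra hc
        have hsq : ‖B.m z‖ₑ ^ 2 ≤ ‖B.m z‖ₑ :=
          pow_le_of_le_one zero_le (not_le.1 hc).le (by norm_num)
        exact lt_irrefl _ ((h2.trans_le hsq).trans hlt)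
      rw [← ENNReal.rpow_two]
      exact ENNReal.rpow_le_rpow_of_exponent_le hone hp
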